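/- Let a finite group $G$ of order $n$ be given to a (uniform-cost, multiplication-free) random access machine by its Cayley table, the elements being numbered in an arbitrary way, and let a subgroup be specified by the list of its elements. (1) There are one program and one polynomial $p$ (both independent of $G$, $n$ and $k$) such that, given the Cayley table of any finite group $G$ of order $n$ and any integer $k \ge 1$, the program halts after at most $p(n^k)$ steps and outputs the list, without repetitions, of exactly those normal subgroups $A$ of $G$ for which $G/A$ has a subnormal series of length $k$ with cyclic or simple factors, that is, a chain of subgroups $1 = N_k \unlhd N_{k-1} \unlhd \dots \unlhd N_0 = G/A$ such that $N_i/N_{i+1}$ is cyclic (possibly trivial) or simple for every $i = 0, \dots, k-1$. (2) There are a program and a polynomial $q$ such that, given the Cayley table of any finite group $G$ of order $n$, the program halts after at most $q(n)$ steps and outputs the list, without repetitions, of exactly those normal subgroups $A$ of $G$ for which $G/A$ is cyclic or simple. -/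

import Mathlib

/-! ## Random access machine with uniform cost

Programs act on finitely many integer variables and finitely many unbounded one-dimensional
integer arrays (the indexed memory), and write to an append-only output list.  The arithmetic is
addition and truncated subtraction; there is no multiplication, so that unit cost is
polynomially equivalent to time on a Turing machine. -/

namespace RAM

/-- Memory contents: `var x` is the value of the variable number `x`, `arr a i` is the cell number
`i` of the array number `a`, and `out` is what has been written to the output so far. -/
@[ext] structure State where
  var : ℕ → ℕ
  arr : ℕ → ℕ → ℕ
  out : List ℕ

/-- Arithmetic expressions; `get a i` reads the array `a` at the (computed) position `i`. -/
inductive Expr where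
  | const (c : ℕ)
  | var (x : ℕ)
  | get (a : ℕ) (i : Expr)
  | add (e f : Expr)
  | sub (e f : Expr)

/-- The value of an expression (`sub` is truncated subtraction). -/
def Expr.eval (s : State) : Expr → ℕ
  | .const c => c
  | .var x => s.var x
  | .get a i => s.arr a (i.eval s)
  | .add e f => e.eval s + f.eval s
  | .sub e f => e.eval s - f.eval s

/-- The number of elementary operations needed to evaluate an expression. -/
def Expr.cost : Expr → ℕ
  | .const _ => 1
  | .var _ => 1
  | .get _ i => i.cost + 1
  | .add e f => e.cost + f.cost + 1
  | .sub e f => e.cost + f.cost + 1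

/-- Programs. The tests of `cond` and `loop` succeed when the value of the expression is not `0`. -/
inductive Prog where
  | skip
  | assign (x : ℕ) (e : Expr)
  | store (a : ℕ) (i e : Expr)
  | emit (e : Expr)
  | seq (P Q : Prog)
  | cond (e : Expr) (P Q : Prog)
  | loop (e : Expr) (P : Prog)

/-- `Exec P s t s'`: started in the state `s`, the program `P` halts in the state `s'` after
exactly `t` elementary steps. -/
inductive Exec : Prog → State → ℕ → State → Prop where
  | skip (s : State) : Exec .skip s 1 s
  | assign (s : State) (x : ℕ) (e : Expr) :
      Exec (.assign x e) s (e.cost + 1) { s with var := Function.update s.var x (e.eval s) }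
  | store (s : State) (a : ℕ) (i e : Expr) :
      Exec (.store a i e) s (i.cost + e.cost + 1)
        { s with arr := Function.update s.arr a
                          (Function.update (s.arr a) (i.eval s) (e.eval s)) }
  | emit (s : State) (e : Expr) :
      Exec (.emit e) s (e.cost + 1) { s with out := s.out ++ [e.eval s] }
  | seq {P Q : Prog} {s s' s'' : State} {t t' : ℕ} :
      Exec P s t s' → Exec Q s' t' s'' → Exec (.seq P Q) s (t + t') s''
  | cond_true {e : Expr} {P Q : Prog} {s s' : State} {t : ℕ} :
      e.eval s ≠ 0 → Exec P s t s' → Exec (.cond e P Q) s (e.cost + 1 + t) s'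
  | cond_false {e : Expr} {P Q : Prog} {s s' : State} {t : ℕ} :
      e.eval s = 0 → Exec Q s t s' → Exec (.cond e P Q) s (e.cost + 1 + t) s'
  | loop_done {e : Expr} {P : Prog} {s : State} :
      e.eval s = 0 → Exec (.loop e P) s (e.cost + 1) s
  | loop_step {e : Expr} {P : Prog} {s s' s'' : State} {t t' : ℕ} :
      e.eval s ≠ 0 → Exec P s t s' → Exec (.loop e P) s' t' s'' →
      Exec (.loop e P) s (e.cost + 1 + t + t') s''

end RAM

/-! ## Groups given by Cayley tables -/

/-- The initial state for a group `G` of order `n` given by its Cayley table, the elements being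
numbered from `0` to `n - 1` by `e`: variable `0` holds `n`, and the array `0` holds the `n × n`
multiplication table, row by row. Everything else is `0`, and the output is empty. -/
def cayleyInput {G : Type*} [Group G] {n : ℕ} (e : G ≃ Fin n) : RAM.State where
  var x := if x = 0 then n else 0
  arr a i :=
    if h : a = 0 ∧ i < n * n then
      (e (e.symm (Fin.divNat ⟨i, h.2⟩) * e.symm (Fin.modNat ⟨i, h.2⟩)) : ℕ)
    else 0
  out := []

/-- The initial state for a group given by its Cayley table together with a number `k`, which is
held by variable `1`. -/
def cayleyInputWith {G : Type*} [Group G] {n : ℕ} (e : G ≃ Fin n) (k : ℕ) : RAM.State :=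
  { cayleyInput e with var := Function.update (cayleyInput e).var 1 k }

/-- The list `l` consists of the numbers of the elements of `A`, each occurring once. -/
def ListsElements {G : Type*} [Group G] {n : ℕ} (e : G ≃ Fin n) (A : Subgroup G)
    (l : List ℕ) : Prop :=
  l.Nodup ∧ ∀ x : ℕ, x ∈ l ↔ ∃ g ∈ A, (e g : ℕ) = x

/-- The output `out` lists exactly the subgroups with the property `S`, each of them once: every
subgroup is written as its order followed by the list of its elements. -/
def OutputsSubgroups {G : Type*} [Group G] {n : ℕ} (e : G ≃ Fin n) (S : Subgroup G → Prop)
    (out : List ℕ) : Prop :=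
  ∃ (As : List (Subgroup G)) (L : List (List ℕ)),
    As.Nodup ∧ (∀ A, A ∈ As ↔ S A) ∧ List.Forall₂ (ListsElements e) As L ∧
      out = L.flatMap fun l => l.length :: l

/-- Started in the state `s`, the program `P` halts within `T` steps, and its output lists
exactly the subgroups with the property `S`. -/
def FindsSubgroupsInTime {G : Type*} [Group G] {n : ℕ} (e : G ≃ Fin n) (P : RAM.Prog)
    (s : RAM.State) (T : ℕ) (S : Subgroup G → Prop) : Prop :=
  ∃ (t : ℕ) (s' : RAM.State), RAM.Exec P s t s' ∧ t ≤ T ∧ OutputsSubgroups e S s'.out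

/-! ## Subnormal series -/

/-- The group `Q` is cyclic or simple (the trivial group is cyclic). -/
def IsCyclicOrSimple (Q : Type*) [Group Q] : Prop :=
  IsCyclic Q ∨ IsSimpleGroup Q

/-- `H` has a subnormal series `1 = N k ⊴ N (k - 1) ⊴ ⋯ ⊴ N 0 = H` of length `k` in which every
factor is cyclic or simple. -/
def HasCyclicOrSimpleSeries (H : Type*) [Group H] (k : ℕ) : Prop :=
  ∃ N : ℕ → Subgroup H, N 0 = ⊤ ∧ N k = ⊥ ∧ ∀ i < k, N (i + 1) ≤ N i ∧
    ∃ _ : ((N (i + 1)).subgroupOf (N i)).Normal,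
      IsCyclicOrSimple (N i ⧸ (N (i + 1)).subgroupOf (N i))

/-!
The normal subgroups `A` in question are the last terms of the descending series of length `k` that
start at `G` and have cyclic or simple factors, so they are found by listing, level by level, the
subgroups that are reached by such series. The levels are small: a normal subgroup of `H` with
cyclic quotient is the kernel of a character of `H`, so that there are at most `|H|` of them, and a
normal subgroup with nonabelian simple quotient consists of those elements whose normal closure in
`H` avoids a suitable element of `H`. Hence every subgroup has at most `2n` successors, and level
`i ≤ k` has at most `(2n) ^ i ≤ (n ^ k) ^ 2` members when `1 < n`. The successors are computable:
for the nonabelian quotients all elements of `H` are tried, and the subgroups with cyclic quotient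
are found by climbing from `⁅H, H⁆` to `H` in steps from `Q` to `Q⟨g⟩`, because a subgroup of
`Q⟨g⟩` that contains `⁅H, H⁆` is generated by its trace on `Q` and a single element, and the trace
has cyclic quotient in `Q` again.

The algorithm is written in a small language with variables for elements, subsets and lists of
subgroups, all of whose loops are bounded. Every command is compiled to the machine, and a weakest
precondition calculus reduces the correctness of the machine program to group theory.
-/

namespace RAM

open Polynomial

/-- A polynomial bound for the running time of a program in terms of a bound for the number of
iterations of each of its loops. -/
noncomputable def Prog.time : Prog → Polynomial ℕ
  | .skip => 1
  | .assign _ e => C (e.cost + 1)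
  | .store _ i e => C (i.cost + e.cost + 1)
  | .emit e => C (e.cost + 1)
  | .seq P Q => P.time + Q.time
  | .cond e P Q => C (e.cost + 1) + P.time + Q.time
  | .loop e P => (X + 1) * (C (e.cost + 1) + P.time)

/-- Started in `s`, the program `P` halts in time `P.time.eval B` in a state satisfying `Φ`. -/
def Runs (B : ℕ) (P : Prog) (s : State) (Φ : State → Prop) : Prop :=
  ∃ t s', Exec P s t s' ∧ t ≤ P.time.eval B ∧ Φ s'

/-- Overwrite a variable. -/
def State.setVar (s : State) (x v : ℕ) : State :=
  { s with var := Function.update s.var x v }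

/-- Overwrite an array cell. -/
def State.setArr (s : State) (a i v : ℕ) : State :=
  { s with arr := Function.update s.arr a (Function.update (s.arr a) i v) }

@[simp] theorem State.setVar_var (s : State) (x v y : ℕ) :
    (s.setVar x v).var y = if y = x then v else s.var y := by
  simp [State.setVar, Function.update_apply]

@[simp] theorem State.setVar_arr (s : State) (x v : ℕ) : (s.setVar x v).arr = s.arr := rfl

@[simp] theorem State.setArr_var (s : State) (a i v : ℕ) : (s.setArr a i v).var = s.var := rfl

@[simp] theorem State.setArr_arr (s : State) (a i v b j : ℕ) :
    (s.setArr a i v).arr b j = if b = a ∧ j = i then v else s.arr b j := by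
  by_cases h : b = a
  · subst h; simp [State.setArr, Function.update_apply]
  · simp [State.setArr, h]

namespace Runs

variable {B : ℕ} {P Q : Prog} {s : State} {Φ Ψ : State → Prop}

theorem mono (h : Runs B P s Φ) (hΦ : ∀ s, Φ s → Ψ s) : Runs B P s Ψ := by
  obtain ⟨t, s', h1, h2, h3⟩ := h
  exact ⟨t, s', h1, h2, hΦ _ h3⟩

theorem skip (h : Φ s) : Runs B .skip s Φ :=
  ⟨1, s, .skip s, by simp [Prog.time], h⟩

theorem assign {x : ℕ} {e : Expr} (h : Φ (s.setVar x (e.eval s))) : Runs B (.assign x e) s Φ :=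
  ⟨_, _, .assign s x e, by simp [Prog.time], h⟩

theorem store {a : ℕ} {i e : Expr} (h : Φ (s.setArr a (i.eval s) (e.eval s))) :
    Runs B (.store a i e) s Φ :=
  ⟨_, _, .store s a i e, by simp [Prog.time], h⟩

theorem emit {e : Expr} (h : Φ { s with out := s.out ++ [e.eval s] }) :
    Runs B (.emit e) s Φ :=
  ⟨_, _, .emit s e, by simp [Prog.time], h⟩

theorem seq (h : Runs B P s fun s' => Runs B Q s' Φ) : Runs B (.seq P Q) s Φ := by
  obtain ⟨t, s', h1, h2, t', s'', h3, h4, h5⟩ := h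
  exact ⟨t + t', s'', .seq h1 h3, by simp only [Prog.time, eval_add]; omega, h5⟩

theorem cond {e : Expr} (h1 : e.eval s ≠ 0 → Runs B P s Φ) (h2 : e.eval s = 0 → Runs B Q s Φ) :
    Runs B (.cond e P Q) s Φ := by
  by_cases h : e.eval s = 0
  · obtain ⟨t, s', h3, h4, h5⟩ := h2 h
    exact ⟨_, s', .cond_false h h3, by simp only [Prog.time, eval_add, eval_C]; omega, h5⟩
  · obtain ⟨t, s', h3, h4, h5⟩ := h1 h
    exact ⟨_, s', .cond_true h h3, by simp only [Prog.time, eval_add, eval_C]; omega, h5⟩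

theorem loop {e : Expr} (m : ℕ) (hm : m ≤ B) (I : ℕ → State → Prop) (h0 : I 0 s)
    (hstep : ∀ i < m, ∀ s, I i s → e.eval s ≠ 0 ∧ Runs B P s (I (i + 1)))
    (hend : ∀ s, I m s → e.eval s = 0 ∧ Φ s) : Runs B (.loop e P) s Φ := by
  have key : ∀ j ≤ m, ∀ s, I (m - j) s → ∃ t s', Exec (.loop e P) s t s' ∧
      t ≤ (j + 1) * (e.cost + 1 + P.time.eval B) ∧ Φ s' := by
    intro j
    induction j with
    | zero =>
      intro _ s hs
      obtain ⟨h1, h2⟩ := hend s hs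
      exact ⟨_, s, .loop_done h1, by omega, h2⟩
    | succ j ih =>
      intro hj s hs
      obtain ⟨h1, t, s', h2, h3, h4⟩ := hstep (m - (j + 1)) (by omega) s hs
      rw [show m - (j + 1) + 1 = m - j by omega] at h4
      obtain ⟨t', s'', h5, h6, h7⟩ := ih (by omega) s' h4
      refine ⟨_, s'', .loop_step h1 h2 h5, ?_, h7⟩
      rw [add_mul (j + 1) 1]
      omega
  obtain ⟨t, s', h1, h2, h3⟩ := key m le_rfl s (by simpa using h0)
  refine ⟨t, s', h1, h2.trans ?_, h3⟩
  simp only [Prog.time, eval_mul, eval_add, eval_X, eval_one, eval_C]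
  gcongr

end Runs

/-- `countTo b c P` runs `P` with the variable `c` running from `0` up to the value of the
variable `b` (exclusive). -/
def Prog.countTo (b c : ℕ) (P : Prog) : Prog :=
  .seq (.assign c (.const 0))
    (.loop (.sub (.var b) (.var c)) (.seq P (.assign c (.add (.var c) (.const 1)))))

theorem Runs.countTo {B : ℕ} {P : Prog} {s : State} {Φ : State → Prop} {b c : ℕ} (m : ℕ)
    (hm : m ≤ B) (hb : s.var b = m) (hbc : b ≠ c) (I : ℕ → State → Prop)
    (h0 : I 0 (s.setVar c 0))
    (hstep : ∀ i < m, ∀ s, s.var c = i → s.var b = m → I i s →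
      Runs B P s fun s' => s'.var c = i ∧ s'.var b = m ∧ I (i + 1) (s'.setVar c (i + 1)))
    (hend : ∀ s, I m s → Φ s) : Runs B (.countTo b c P) s Φ := by
  refine .seq (.assign ?_)
  refine .loop m hm (fun i s => s.var c = i ∧ s.var b = m ∧ I i s)
    ⟨by simp [Expr.eval], by simp [hbc, hb], h0⟩ ?_ ?_
  · rintro i hi s ⟨h1, h2, h3⟩
    refine ⟨by simp [Expr.eval, h1, h2]; omega, .seq ((hstep i hi s h1 h2 h3).mono ?_)⟩
    rintro s' ⟨h4, h5, h6⟩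
    refine .assign ⟨by simp [Expr.eval, h4], by simp [hbc, h5], ?_⟩
    simpa [Expr.eval, h4] using h6
  · rintro s ⟨h1, h2, h3⟩
    exact ⟨by simp [Expr.eval, h1, h2], hend s h3⟩

end RAM

/-! ## Computing with elements, subsets and lists of subgroups -/

/-- Names of the variables for group elements. -/
inductive ElemReg where
  | x₁ | x₂ | x₃ | x₄ | x₅ | member | generator | step | avoided

/-- Names of the variables for sets of group elements: `group` holds the subgroup whose sections are
being listed, and `stage`, `kernel` and `target` hold subgroups of it. -/
inductive SetReg where
  | group | stage | kernel | target | closure | generators | found | listed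

/-- Names of the variables for lists of subgroups. -/
inductive ListReg where
  | level | nextLevel | cyclic | nextCyclic

theorem ElemReg.ctorIdx_injective : Function.Injective ElemReg.ctorIdx := by
  rintro ⟨⟩ ⟨⟩ h <;> first | rfl | cases h

theorem SetReg.ctorIdx_injective : Function.Injective SetReg.ctorIdx := by
  rintro ⟨⟩ ⟨⟩ h <;> first | rfl | cases h

theorem ListReg.ctorIdx_injective : Function.Injective ListReg.ctorIdx := by
  rintro ⟨⟩ ⟨⟩ h <;> first | rfl | cases h

instance : DecidableEq ElemReg := ElemReg.ctorIdx_injective.decidableEq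

instance : DecidableEq SetReg := SetReg.ctorIdx_injective.decidableEq

instance : DecidableEq ListReg := ListReg.ctorIdx_injective.decidableEq

/-- First-order formulas in the multiplication of a group and finitely many set variables. -/
inductive Fml where
  | mem (x : ElemReg) (r : SetReg)
  | eq (x y : ElemReg)
  | mul (x y z : ElemReg)
  | neg (φ : Fml)
  | and (φ ψ : Fml)
  | ex (x : ElemReg) (φ : Fml)

namespace Fml

/-- Disjunction. -/
def or (φ ψ : Fml) : Fml := neg (and (neg φ) (neg ψ))

/-- Implication. -/
def imp (φ ψ : Fml) : Fml := neg (and φ (neg ψ))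

/-- Universal quantification. -/
def all (x : ElemReg) (φ : Fml) : Fml := neg (ex x (neg φ))

/-- Equality of two sets. -/
def eqSet (r s : SetReg) : Fml :=
  all .x₁ (and (imp (mem .x₁ r) (mem .x₁ s)) (imp (mem .x₁ s) (mem .x₁ r)))

variable {G : Type*} [Group G]

/-- Truth of a formula under an assignment of elements and sets. -/
def Sat (v : ElemReg → G) (A : SetReg → Set G) : Fml → Prop
  | mem x r => v x ∈ A r
  | eq x y => v x = v y
  | mul x y z => v x * v y = v z
  | neg φ => ¬ φ.Sat v A
  | and φ ψ => φ.Sat v A ∧ ψ.Sat v A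
  | ex x φ => ∃ g, φ.Sat (Function.update v x g) A

variable {v : ElemReg → G} {A : SetReg → Set G} {φ ψ : Fml} {x y z : ElemReg} {r s : SetReg}

@[simp] theorem sat_mem : (mem x r).Sat v A ↔ v x ∈ A r := Iff.rfl

@[simp] theorem sat_eq : (eq x y).Sat v A ↔ v x = v y := Iff.rfl

@[simp] theorem sat_mul : (mul x y z).Sat v A ↔ v x * v y = v z := Iff.rfl

@[simp] theorem sat_neg : (neg φ).Sat v A ↔ ¬ φ.Sat v A := Iff.rfl

@[simp] theorem sat_and : (and φ ψ).Sat v A ↔ φ.Sat v A ∧ ψ.Sat v A := Iff.rfl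

@[simp] theorem sat_ex : (ex x φ).Sat v A ↔ ∃ g, φ.Sat (Function.update v x g) A := Iff.rfl

@[simp] theorem sat_or : (or φ ψ).Sat v A ↔ φ.Sat v A ∨ ψ.Sat v A := by
  simp only [or, sat_neg, sat_and]; tauto

@[simp] theorem sat_imp : (imp φ ψ).Sat v A ↔ (φ.Sat v A → ψ.Sat v A) := by
  simp only [imp, sat_neg, sat_and]; tauto

@[simp] theorem sat_all : (all x φ).Sat v A ↔ ∀ g, φ.Sat (Function.update v x g) A := by
  simp [all]

@[simp] theorem sat_eqSet : (eqSet r s).Sat v A ↔ A r = A s := by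
  simp only [eqSet, sat_all, sat_and, sat_imp, sat_mem, Function.update_self, Set.ext_iff,
    iff_iff_implies_and_implies]

end Fml

/-- Commands. `forE x C` runs `C` with every group element as the value of the element variable `x`,
`rep C` repeats `C` a number of times that is fixed in advance, and `forL l r C` runs `C` with every
member of the list `l` as the value of the set variable `r`. -/
inductive Cmd where
  | skip
  | seq (C D : Cmd)
  | ite (φ : Fml) (C D : Cmd)
  | add (x : ElemReg) (r : SetReg)
  | del (x : ElemReg) (r : SetReg)
  | forE (x : ElemReg) (C : Cmd)
  | rep (C : Cmd)
  | forL (l : ListReg) (r : SetReg) (C : Cmd)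
  | push (l : ListReg) (r : SetReg)
  | nil (l : ListReg)
  | emit (r : SetReg)

/-- The values of the set variables and the list variables, and the output. -/
structure Store (G : Type*) [Group G] where
  set : SetReg → Set G
  list : ListReg → List (Subgroup G)
  out : List ℕ

namespace Store

variable {G : Type*} [Group G]

/-- Overwrite a set variable. -/
def setSet (a : Store G) (r : SetReg) (S : Set G) : Store G :=
  { a with set := Function.update a.set r S }

/-- Overwrite a list variable. -/
def setList (a : Store G) (l : ListReg) (L : List (Subgroup G)) : Store G :=
  { a with list := Function.update a.list l L }

/-- Append to the output. -/
def addOut (a : Store G) (o : List ℕ) : Store G :=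
  { a with out := a.out ++ o }

variable (a : Store G) (r : SetReg) (S T : Set G) (l : ListReg) (L : List (Subgroup G))
  (o : List ℕ)

@[simp] theorem set_setSet : (a.setSet r S).set = Function.update a.set r S := rfl

@[simp] theorem list_setSet : (a.setSet r S).list = a.list := rfl

@[simp] theorem out_setSet : (a.setSet r S).out = a.out := rfl

@[simp] theorem list_setList : (a.setList l L).list = Function.update a.list l L := rfl

@[simp] theorem set_addOut : (a.addOut o).set = a.set := rfl

@[simp] theorem out_addOut : (a.addOut o).out = a.out ++ o := rfl

@[simp] theorem setSet_self : a.setSet r (a.set r) = a := by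
  simp [setSet]

@[simp] theorem setSet_setSet : (a.setSet r S).setSet r T = a.setSet r T := by
  simp [setSet]

end Store

namespace Cmd

section

variable {G : Type*} [Group G] {n : ℕ} (e : G ≃ Fin n) (K B : ℕ)

/-- `C.wp e K B Φ v a`: started with the element variables `v` in the store `a`, the command `C`
ends in a store with the property `Φ`. The loops visit group elements and members of a list in an
unspecified order, so that their invariants are indexed by the set of those already visited; `K` is
the number of repetitions of a `rep` loop, and `B` bounds the length of the lists that are
traversed. -/
def wp : Cmd → (Store G → Prop) → (ElemReg → G) → Store G → Prop
  | skip, Φ, _, a => Φ a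
  | seq C D, Φ, v, a => C.wp (D.wp Φ v) v a
  | ite φ C D, Φ, v, a => (φ.Sat v a.set → C.wp Φ v a) ∧ (¬ φ.Sat v a.set → D.wp Φ v a)
  | add x r, Φ, v, a => Φ (a.setSet r (insert (v x) (a.set r)))
  | del x r, Φ, v, a => Φ (a.setSet r (a.set r \ {v x}))
  | forE x C, Φ, v, a => ∃ I : Set G → Store G → Prop, I ∅ a ∧
      (∀ V, ∀ g ∉ V, ∀ b, I V b → C.wp (I (insert g V)) (Function.update v x g) b) ∧
      ∀ b, I Set.univ b → Φ b
  | rep C, Φ, v, a => ∃ I : ℕ → Store G → Prop, I 0 a ∧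
      (∀ i < K, ∀ b, I i b → C.wp (I (i + 1)) v b) ∧ ∀ b, I K b → Φ b
  | forL l r C, Φ, v, a => (a.list l).Nodup ∧ (a.list l).length ≤ B ∧
      ∃ I : Set (Subgroup G) → Store G → Prop, I ∅ a ∧
      (∀ V ⊆ {N | N ∈ a.list l}, ∀ b, I V b → b.list l = a.list l ∧
        ∀ N ∈ a.list l, N ∉ V → C.wp (I (insert N V)) v (b.setSet r N)) ∧
      ∀ b, I {N | N ∈ a.list l} b → Φ b
  | push l r, Φ, _, a => ∃ N : Subgroup G, N = a.set r ∧ Φ (a.setList l (a.list l ++ [N]))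
  | nil l, Φ, _, a => Φ (a.setList l [])
  | emit r, Φ, _, a => ∃ N : Subgroup G, N = a.set r ∧
      ∀ o, ListsElements e N o → Φ (a.addOut (o.length :: o))

end

end Cmd

open RAM

/-! ## Compilation to the random access machine -/

/-- The variables of the machine: the order of the group, the number of repetitions of a `rep` loop,
the number of the value of an element variable, the length of a list variable times the order of the
group, and a stack for intermediate results. -/
inductive VarSlot where
  | size
  | iter
  | elem (x : ElemReg)
  | len (l : ListReg)
  | scratch (d : ℕ)

/-- The arrays of the machine: the Cayley table, the multiples of the order of the group (they
replace the multiplication in the position of a table entry), the indicator function of a set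
variable, and the indicator functions of the members of a list variable, one after the other. -/
inductive ArrSlot where
  | table
  | offset
  | set (r : SetReg)
  | rows (l : ListReg)

/-- The number of a variable. -/
def VarSlot.code : VarSlot → ℕ
  | size => 0
  | iter => 1
  | elem x => 3 * x.ctorIdx + 2
  | len l => 3 * l.ctorIdx + 3
  | scratch d => 3 * d + 4

/-- The number of an array. -/
def ArrSlot.code : ArrSlot → ℕ
  | table => 0
  | offset => 1
  | set r => 2 * r.ctorIdx + 2
  | rows l => 2 * l.ctorIdx + 3

instance : Coe VarSlot ℕ := ⟨VarSlot.code⟩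

instance : Coe ArrSlot ℕ := ⟨ArrSlot.code⟩

theorem VarSlot.code_injective : Function.Injective VarSlot.code := by
  rintro (_ | _ | x | l | d) (_ | _ | x' | l' | d') h <;> simp only [code] at h <;>
    first
      | rfl
      | omega
      | exact congrArg elem (ElemReg.ctorIdx_injective (by omega))
      | exact congrArg len (ListReg.ctorIdx_injective (by omega))
      | exact congrArg scratch (by omega)

theorem ArrSlot.code_injective : Function.Injective ArrSlot.code := by
  rintro (_ | _ | r | l) (_ | _ | r' | l') h <;> simp only [code] at h <;>
    first
      | rfl
      | omega
      | exact congrArg set (SetReg.ctorIdx_injective (by omega))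
      | exact congrArg rows (ListReg.ctorIdx_injective (by omega))

@[simp] theorem VarSlot.code_inj {i j : VarSlot} : i.code = j.code ↔ i = j := code_injective.eq_iff

@[simp] theorem ArrSlot.code_inj {i j : ArrSlot} : i.code = j.code ↔ i = j := code_injective.eq_iff

/-- An expression that is nonzero if and only if the two given ones have the same value. -/
def eqTest (E F : Expr) : Expr := .sub (.const 1) (.add (.sub E F) (.sub F E))

theorem eval_eqTest_ne_zero {E F : Expr} {s : State} :
    (eqTest E F).eval s ≠ 0 ↔ E.eval s = F.eval s := by
  simp only [eqTest, Expr.eval]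
  omega

/-- Run `P` with every number below the order of the group as the value of the variable of `x`, and
restore this variable; the scratch variables `d` and `d + 1` hold the old value and a counter. -/
def forElem (x : ElemReg) (d : ℕ) (P : Prog) : Prog :=
  .seq (.assign (VarSlot.scratch d) (.var (VarSlot.elem x))) <|
  .seq (.countTo VarSlot.size (VarSlot.scratch (d + 1)) <|
    .seq (.assign (VarSlot.elem x) (.var (VarSlot.scratch (d + 1)))) P) <|
  .assign (VarSlot.elem x) (.var (VarSlot.scratch d))

/-- A program that decides a formula; the result is left in the scratch variable `d`, and the
scratch variables below `d` are not modified. -/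
def Fml.prog : Fml → ℕ → Prog
  | mem x r, d =>
      .assign (VarSlot.scratch d) (.get (ArrSlot.set r) (.var (VarSlot.elem x)))
  | eq x y, d =>
      .assign (VarSlot.scratch d) (eqTest (.var (VarSlot.elem x)) (.var (VarSlot.elem y)))
  | mul x y z, d =>
      .assign (VarSlot.scratch d) <| eqTest
        (.get ArrSlot.table
          (.add (.get ArrSlot.offset (.var (VarSlot.elem x))) (.var (VarSlot.elem y))))
        (.var (VarSlot.elem z))
  | neg φ, d =>
      .seq (φ.prog d) <|
      .assign (VarSlot.scratch d) (.sub (.const 1) (.var (VarSlot.scratch d)))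
  | and φ ψ, d => .seq (φ.prog d) (.cond (.var (VarSlot.scratch d)) (ψ.prog d) .skip)
  | ex x φ, d =>
      .seq (.assign (VarSlot.scratch d) (.const 0)) <|
      forElem x (d + 1) <| .seq (φ.prog (d + 3)) <|
        .cond (.var (VarSlot.scratch (d + 3))) (.assign (VarSlot.scratch d) (.const 1)) .skip

namespace Cmd

/-- Copy the member of `l` that starts at the position in the scratch variable `d` to `r`. -/
def loadProg (l : ListReg) (r : SetReg) (d : ℕ) : Prog :=
  forElem .x₁ (d + 1) <|
    .store (ArrSlot.set r) (.var (VarSlot.elem .x₁))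
      (.get (ArrSlot.rows l) (.add (.var (VarSlot.scratch d)) (.var (VarSlot.elem .x₁))))

/-- Append the set `r` to the list `l`, with scratch variables from `d` on. -/
def pushProg (l : ListReg) (r : SetReg) (d : ℕ) : Prog :=
  .seq (.countTo VarSlot.size (VarSlot.scratch d) <|
    .store (ArrSlot.rows l) (.add (.var (VarSlot.len l)) (.var (VarSlot.scratch d)))
      (.get (ArrSlot.set r) (.var (VarSlot.scratch d)))) <|
  .assign (VarSlot.len l) (.add (.var (VarSlot.len l)) (.var VarSlot.size))

/-- Leave the number of elements of the set `r` in the scratch variable `d`. -/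
def countProg (r : SetReg) (d : ℕ) : Prog :=
  .seq (.assign (VarSlot.scratch d) (.const 0)) <|
  forElem .x₁ (d + 1) <| .cond (.get (ArrSlot.set r) (.var (VarSlot.elem .x₁)))
    (.assign (VarSlot.scratch d) (.add (.var (VarSlot.scratch d)) (.const 1))) .skip

/-- Output the elements of the set `r`, with scratch variables from `d` on. -/
def emitElementsProg (r : SetReg) (d : ℕ) : Prog :=
  forElem .x₁ d <| .cond (.get (ArrSlot.set r) (.var (VarSlot.elem .x₁)))
    (.emit (.var (VarSlot.elem .x₁))) .skip

/-- The program of a command, with scratch variables from `d` on. -/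
def prog : Cmd → ℕ → Prog
  | skip, _ => .skip
  | seq C D, d => .seq (C.prog d) (D.prog d)
  | ite φ C D, d => .seq (φ.prog d) (.cond (.var (VarSlot.scratch d)) (C.prog d) (D.prog d))
  | add x r, _ => .store (ArrSlot.set r) (.var (VarSlot.elem x)) (.const 1)
  | del x r, _ => .store (ArrSlot.set r) (.var (VarSlot.elem x)) (.const 0)
  | forE x C, d => forElem x d (C.prog (d + 2))
  | rep C, d => .countTo VarSlot.iter (VarSlot.scratch d) (C.prog (d + 1))
  | forL l r C, d =>
      .seq (.assign (VarSlot.scratch d) (.const 0)) <|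
      .loop (.sub (.var (VarSlot.len l)) (.var (VarSlot.scratch d))) <|
      .seq (loadProg l r d) <|
      .seq (C.prog (d + 1)) <|
      .assign (VarSlot.scratch d) (.add (.var (VarSlot.scratch d)) (.var VarSlot.size))
  | push l r, d => pushProg l r d
  | nil l, _ => .assign (VarSlot.len l) (.const 0)
  | emit r, d =>
      .seq (countProg r d) <| .seq (.emit (.var (VarSlot.scratch d))) (emitElementsProg r (d + 1))

end Cmd

section

variable {G : Type*} [Group G] {n : ℕ}

/-- The memory `s` represents the element variables `v` and the store `a`, and its lowest scratch
variables hold the stack `t`, whose top is the head of the list. -/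
structure Represents (e : G ≃ Fin n) (K : ℕ) (s : State) (v : ElemReg → G) (t : List ℕ)
    (a : Store G) : Prop where
  size : s.var VarSlot.size = n
  iter : s.var VarSlot.iter = K
  table : ∀ g h : G, s.arr ArrSlot.table ((e g : ℕ) * n + e h) = e (g * h)
  offset : ∀ g : G, s.arr ArrSlot.offset (e g) = e g * n
  elem : ∀ x, s.var (VarSlot.elem x) = e (v x)
  set : ∀ r g, s.arr (ArrSlot.set r) (e g) ≠ 0 ↔ g ∈ a.set r
  len : ∀ l, s.var (VarSlot.len l) = (a.list l).length * n
  row : ∀ l i (hi : i < (a.list l).length) g,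
    s.arr (ArrSlot.rows l) (i * n + e g) ≠ 0 ↔ g ∈ (a.list l)[i]
  scratch : ∀ j r, j :: r <:+ t → s.var (VarSlot.scratch r.length) = j
  out : s.out = a.out

namespace Represents

variable {e : G ≃ Fin n} {K B : ℕ} {s : State} {v : ElemReg → G} {t : List ℕ} {a : Store G}
  {i j : ℕ}

theorem push (h : Represents e K s v t a) (hj : s.var (VarSlot.scratch t.length) = j) :
    Represents e K s v (j :: t) a :=
  { h with
    scratch := fun k r hr => (List.suffix_cons_iff.1 hr).elim
      (fun h' => by cases h'; exact hj) (h.scratch k r) }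

theorem pop (h : Represents e K s v (j :: t) a) : Represents e K s v t a :=
  { h with scratch := fun k r hr => h.scratch k r (hr.trans (List.suffix_cons j t)) }

theorem top (h : Represents e K s v (j :: t) a) : s.var (VarSlot.scratch t.length) = j :=
  h.scratch j t List.suffix_rfl

theorem setScratch (h : Represents e K s v t a) {d : ℕ} (hd : t.length ≤ d) (j : ℕ) :
    Represents e K (s.setVar (VarSlot.scratch d) j) v t a where
  size := by simp [h.size]
  iter := by simp [h.iter]
  table := h.table
  offset := h.offset
  elem x := by simp [h.elem]
  set := h.set
  len l := by simp [h.len]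
  row := h.row
  scratch k r hr := by
    have hlt : r.length < d := hr.length_le.trans hd
    simp [hlt.ne, h.scratch k r hr]
  out := h.out

theorem pushScratch (h : Represents e K s v t a) (j : ℕ) :
    Represents e K (s.setVar (VarSlot.scratch t.length) j) v (j :: t) a :=
  (h.setScratch le_rfl j).push (by simp)

theorem setScratch_third {k : ℕ} (h : Represents e K s v (i :: j :: k :: t) a) (k' : ℕ) :
    Represents e K (s.setVar (VarSlot.scratch t.length) k') v (i :: j :: k' :: t) a :=
  ((h.pop.pop.pop.pushScratch k').push (by simpa using h.pop.top)).push
    (by simpa [show t.length + 1 + 1 ≠ t.length by omega] using h.top)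

theorem setElem (h : Represents e K s v t a) (x : ElemReg) (g : G) :
    Represents e K (s.setVar (VarSlot.elem x) (e g)) (Function.update v x g) t a where
  size := by simp [h.size]
  iter := by simp [h.iter]
  table := h.table
  offset := h.offset
  elem y := by
    rcases eq_or_ne y x with rfl | hy
    · simp
    · simp [hy, h.elem]
  set := h.set
  len l := by simp [h.len]
  row := h.row
  scratch k r hr := by simp [h.scratch k r hr]
  out := h.out

theorem setSet (h : Represents e K s v t a) {r : SetReg} {g : G} {w : ℕ} {S : Set G}
    (hg : w ≠ 0 ↔ g ∈ S) (hS : ∀ k ≠ g, k ∈ S ↔ k ∈ a.set r) :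
    Represents e K (s.setArr (ArrSlot.set r) (e g) w) v t (a.setSet r S) where
  size := h.size
  iter := h.iter
  table := by simp [h.table]
  offset := by simp [h.offset]
  elem := h.elem
  set q k := by
    rcases eq_or_ne q r with rfl | hq
    · rcases eq_or_ne k g with rfl | hk
      · simpa using hg
      · simp [← Fin.ext_iff, hk, hS k hk, ← h.set q k]
    · simp [hq, ← h.set q k]
  len := h.len
  row := by simpa using h.row
  scratch := h.scratch
  out := h.out

theorem nil (h : Represents e K s v t a) (l : ListReg) :
    Represents e K (s.setVar (VarSlot.len l) 0) v t (a.setList l []) where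
  size := by simp [h.size]
  iter := by simp [h.iter]
  table := h.table
  offset := h.offset
  elem x := by simp [h.elem]
  set := h.set
  len m := by
    rcases eq_or_ne m l with rfl | hm
    · simp
    · simp [hm, h.len]
  row m i hi g := by
    rcases eq_or_ne m l with rfl | hm
    · simp at hi
    · simp only [Store.list_setList, Function.update_of_ne hm] at hi ⊢
      exact h.row m i hi g
  scratch k r hr := by simp [h.scratch k r hr]
  out := h.out

theorem addOut (h : Represents e K s v t a) (o : List ℕ) :
    Represents e K { s with out := s.out ++ o } v t (a.addOut o) :=
  { h with out := by simp [h.out] }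

end Represents

end

theorem ListsElements.length_eq {G : Type*} [Group G] {n : ℕ} {e : G ≃ Fin n} {A : Subgroup G}
    {o : List ℕ} (h : ListsElements e A o) : o.length = (A : Set G).ncard := by
  classical
  have himage : (o.toFinset : Set ℕ) = (fun g => (e g : ℕ)) '' A := by
    ext x; simp [h.2]
  rw [← List.toFinset_card_of_nodup h.1, ← Set.ncard_coe_finset, himage,
    Set.ncard_image_of_injective _ fun g h hgh => e.injective (Fin.ext hgh)]

theorem setOf_lt_succ {α : Type*} {n : ℕ} {e : α ≃ Fin n} (i : Fin n) :
    {g : α | (e g : ℕ) < i + 1} = insert (e.symm i) {g | (e g : ℕ) < i} := by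
  ext g
  rw [Set.mem_insert_iff, Equiv.eq_symm_apply, Fin.ext_iff]
  exact Nat.lt_succ_iff_lt_or_eq.trans or_comm

section

variable {G : Type*} [Group G] {n : ℕ} {e : G ≃ Fin n} {K B : ℕ} {s : State} {v : ElemReg → G}
  {t : List ℕ} {a : Store G} {Φ : State → Prop}

theorem runs_forElem {x : ElemReg} {P : Prog} (hn : n ≤ B) (h : Represents e K s v t a)
    (J : Set G → List ℕ → Store G → Prop) (hJ : J ∅ t a)
    (hstep : ∀ V, ∀ g ∉ V, ∀ s t' b, t'.length = t.length → J V t' b →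
      Represents e K s (Function.update v x g) (e g :: e (v x) :: t') b →
      Runs B P s fun s' => ∃ t'' c, t''.length = t.length ∧ J (insert g V) t'' c ∧
        Represents e K s' (Function.update v x g) (e g :: e (v x) :: t'') c)
    (hend : ∀ s t' b, t'.length = t.length → J Set.univ t' b → Represents e K s v t' b → Φ s) :
    Runs B (forElem x t.length P) s Φ := by
  refine .seq (.assign (.seq (.countTo n hn (by simp [h.size]) (by simp) (fun i s => ∃ g t' b,
    t'.length = t.length ∧ J {k | (e k : ℕ) < i} t' b ∧
      Represents e K s (Function.update v x g) (e (v x) :: t') b) ?_ ?_ ?_)))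
  · refine ⟨v x, t, a, rfl, by simpa using hJ, ?_⟩
    rw [Function.update_eq_self, Expr.eval, h.elem]
    exact (h.pushScratch _).setScratch (by simp) _
  · rintro i hi s hc - ⟨g, t', b, ht, hb, hs⟩
    have hs' := (hs.push (by simpa [ht] using hc)).setElem x (e.symm ⟨i, hi⟩)
    rw [Function.update_idem] at hs'
    refine .seq (.assign ((hstep _ (e.symm ⟨i, hi⟩) (by simp) _ t' b ht hb
      (by simpa [Expr.eval, hc] using hs')).mono ?_))
    rintro s' ⟨t'', c, ht', hc', hs''⟩
    refine ⟨?_, by simpa using hs''.size, e.symm ⟨i, hi⟩, t'', c, ht', ?_,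
      hs''.pop.setScratch (by simp [ht']) _⟩
    · simpa [ht'] using hs''.top
    · rwa [← setOf_lt_succ] at hc'
  · rintro s ⟨g, t', b, ht, hb, hs⟩
    have huniv : {k : G | (e k : ℕ) < n} = Set.univ := by simp
    rw [huniv] at hb
    have hs' := hs.pop.setElem x (v x)
    rw [Function.update_idem, Function.update_eq_self] at hs'
    refine .assign (hend _ t' b ht hb ?_)
    rwa [Expr.eval, ← ht, hs.top]

theorem Represents.eval_elem (h : Represents e K s v t a) (x : ElemReg) :
    (Expr.var (VarSlot.elem x)).eval s = e (v x) :=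
  h.elem x

theorem Represents.eval_mul (h : Represents e K s v t a) (x y : ElemReg) :
    (Expr.get ArrSlot.table (.add (.get ArrSlot.offset (.var (VarSlot.elem x)))
      (.var (VarSlot.elem y)))).eval s = e (v x * v y) := by
  simp only [Expr.eval, h.elem, h.offset, h.table]

theorem Represents.eval_mem (h : Represents e K s v t a) (x : ElemReg) (r : SetReg) :
    (Expr.get (ArrSlot.set r) (.var (VarSlot.elem x))).eval s ≠ 0 ↔ v x ∈ a.set r := by
  rw [Expr.eval, h.eval_elem, h.set]

theorem Fml.runs_ex {x : ElemReg} {φ : Fml} (hn : n ≤ B) (h : Represents e K s v t a)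
    (hφ : ∀ {s v t}, Represents e K s v t a → Runs B (φ.prog t.length) s fun s' =>
      ∃ r, Represents e K s' v (r :: t) a ∧ (r ≠ 0 ↔ φ.Sat v a.set)) :
    Runs B ((Fml.ex x φ).prog t.length) s fun s' =>
      ∃ r, Represents e K s' v (r :: t) a ∧ (r ≠ 0 ↔ (Fml.ex x φ).Sat v a.set) := by
  refine .seq (.assign (runs_forElem hn (h.pushScratch 0)
    (fun V t' b => ∃ r, t' = r :: t ∧ a = b ∧
      (r ≠ 0 ↔ ∃ g ∈ V, φ.Sat (Function.update v x g) a.set)) ⟨0, rfl, rfl, by simp⟩ ?_ ?_))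
  · rintro V g - s t' b - ⟨r, rfl, rfl, hr⟩ hs
    refine .seq ((hφ hs).mono ?_)
    rintro s' ⟨r', hs', hr'⟩
    have htest : (Expr.var (VarSlot.scratch (t.length + 3))).eval s' = r' := hs'.top
    simp only [Set.mem_insert_iff, exists_eq_or_imp]
    refine .cond (fun hc => .assign ⟨1 :: t, a, rfl, ⟨1, rfl, rfl, ?_⟩, hs'.pop.setScratch_third 1⟩)
      fun hc => .skip ⟨r :: t, a, rfl, ⟨r, rfl, rfl, ?_⟩, hs'.pop⟩
    · simp [hr'.1 (htest ▸ hc)]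
    · rw [or_iff_right fun hφ' => hr'.2 hφ' (htest ▸ hc), hr]
  · rintro s t' b - ⟨r, rfl, rfl, hr⟩ hs
    exact ⟨r, hs, by simpa using hr⟩

theorem Fml.runs (φ : Fml) (hn : n ≤ B) (h : Represents e K s v t a) :
    Runs B (φ.prog t.length) s fun s' =>
      ∃ r, Represents e K s' v (r :: t) a ∧ (r ≠ 0 ↔ φ.Sat v a.set) := by
  induction φ generalizing s v t with
  | mem x r => exact .assign ⟨_, h.pushScratch _, h.eval_mem x r⟩
  | eq x y =>
    refine .assign ⟨_, h.pushScratch _, ?_⟩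
    rw [eval_eqTest_ne_zero, h.eval_elem, h.eval_elem, ← Fin.ext_iff, e.apply_eq_iff_eq, sat_eq]
  | mul x y z =>
    refine .assign ⟨_, h.pushScratch _, ?_⟩
    rw [eval_eqTest_ne_zero, h.eval_mul, h.eval_elem, ← Fin.ext_iff, e.apply_eq_iff_eq, sat_mul]
  | neg φ ih =>
    refine .seq ((ih h).mono fun s' ⟨r, hs, hr⟩ => .assign ⟨_, hs.pop.pushScratch _, ?_⟩)
    simp only [Expr.eval, hs.top, sat_neg, ← hr]
    omega
  | and φ ψ ihφ ihψ =>
    refine .seq ((ihφ h).mono fun s' ⟨r, hs, hr⟩ => ?_)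
    have htest : (Expr.var (VarSlot.scratch t.length)).eval s' = r := hs.top
    refine .cond (fun hc => (ihψ hs.pop).mono fun s'' ⟨r', hs'', hr'⟩ => ⟨r', hs'', ?_⟩)
      fun hc => .skip ⟨r, hs, ?_⟩
    · rw [hr', sat_and, and_iff_right (hr.1 (htest ▸ hc))]
    · rw [sat_and, ← hr]
      simp [← htest, hc]
  | ex x φ ih => exact runs_ex hn h ih

namespace Cmd

theorem runs_loadProg {l : ListReg} {r : SetReg} {i : ℕ} (hn : n ≤ B) (hi : i < (a.list l).length)
    (h : Represents e K s v (i * n :: t) a) :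
    Runs B (loadProg l r t.length) s fun s' =>
      Represents e K s' v (i * n :: t) (a.setSet r (a.list l)[i]) := by
  refine runs_forElem hn h
    (fun V t' b => t' = i * n :: t ∧ ∃ T, b = a.setSet r T ∧ ∀ g ∈ V, g ∈ T ↔ g ∈ (a.list l)[i])
    ⟨rfl, a.set r, by simp, by simp⟩ ?_ ?_
  · rintro V g hg s t' b - ⟨rfl, T, rfl, hT⟩ hs
    have hpos : s.var (VarSlot.scratch t.length) = i * n := hs.pop.pop.top
    have hset := hs.setSet (r := r) (g := g)
      (w := s.arr (ArrSlot.rows l) (i * n + e g))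
      (S := {k | k ∈ T \ {g} ∨ k = g ∧ g ∈ (a.list l)[i]})
      (by simpa using hs.row l i hi g) (by simp +contextual)
    rw [Store.setSet_setSet] at hset
    refine .store ⟨_, _, rfl, ⟨rfl, _, rfl, ?_⟩, by simpa [Expr.eval, hs.elem, hpos] using hset⟩
    rintro k (rfl | hk)
    · simp
    · simp [ne_of_mem_of_not_mem hk hg, hT k hk]
  · rintro s t' b - ⟨rfl, T, rfl, hT⟩ hs
    rwa [Set.ext fun g => hT g trivial] at hs

end Cmd

theorem Represents.setFreeCell (h : Represents e K s v t a) {l : ListReg} {i : ℕ}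
    (hi : (a.list l).length * n ≤ i) (w : ℕ) :
    Represents e K (s.setArr (ArrSlot.rows l) i w) v t a :=
  { h with
    table := by simpa using h.table
    offset := by simpa using h.offset
    set := by simpa using h.set
    row := fun m j hj g => by
      have hlt : j * n + e g < (a.list m).length * n :=
        mul_comm n j ▸ Nat.mul_add_lt_mul_of_lt_of_lt hj (e g).2
      have hne : ¬ (m = l ∧ j * n + (e g : ℕ) = i) := by rintro ⟨rfl, rfl⟩; omega
      simpa [hne] using h.row m j hj g }

theorem Represents.append (h : Represents e K s v t a) {l : ListReg} {N : Subgroup G}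
    (hN : ∀ g, s.arr (ArrSlot.rows l) ((a.list l).length * n + e g) ≠ 0 ↔ g ∈ N) :
    Represents e K (s.setVar (VarSlot.len l) ((a.list l).length * n + n)) v t
      (a.setList l (a.list l ++ [N])) where
  size := by simp [h.size]
  iter := by simp [h.iter]
  table := h.table
  offset := h.offset
  elem x := by simp [h.elem]
  set := h.set
  len m := by
    rcases eq_or_ne m l with rfl | hm
    · simp [add_mul]
    · simp [hm, h.len]
  row m i hi g := by
    rcases eq_or_ne m l with rfl | hm
    · simp only [Store.list_setList, Function.update_self, List.length_append,
        List.length_singleton] at hi ⊢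
      rcases Nat.lt_succ_iff_lt_or_eq.1 hi with hi | rfl
      · simpa [List.getElem_append_left hi] using h.row m i hi g
      · simpa using hN g
    · simp only [Store.list_setList, Function.update_of_ne hm] at hi ⊢
      exact h.row m i hi g
  scratch k r hr := by simp [h.scratch k r hr]
  out := h.out

namespace Cmd

theorem runs_pushProg {l : ListReg} {r : SetReg} {N : Subgroup G} (hn : n ≤ B)
    (h : Represents e K s v t a) (hN : (N : Set G) = a.set r) :
    Runs B (pushProg l r t.length) s fun s' =>
      Represents e K s' v t (a.setList l (a.list l ++ [N])) := by
  refine .seq (.countTo n hn h.size (by simp) (fun i s => Represents e K s v t a ∧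
    ∀ g, (e g : ℕ) < i →
      (s.arr (ArrSlot.rows l) ((a.list l).length * n + e g) ≠ 0 ↔ g ∈ N)) ?_ ?_ ?_)
  · exact ⟨h.setScratch le_rfl 0, by simp⟩
  · rintro i - s hc hsize ⟨hs, hcells⟩
    refine .store ⟨hc, hsize, (hs.setFreeCell ?_ _).setScratch le_rfl _, fun g hg => ?_⟩
    · simp only [Expr.eval, hs.len]; omega
    rcases Nat.lt_succ_iff_lt_or_eq.1 hg with hlt | heq
    · simpa [Expr.eval, hc, hs.len, hlt.ne] using hcells g hlt
    · rw [← SetLike.mem_coe, hN, ← hs.set, heq]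
      simp [Expr.eval, hc, hs.len]
  · rintro s ⟨hs, hcells⟩
    refine .assign ?_
    simp only [Expr.eval, hs.len, hs.size]
    exact hs.append fun g => hcells g (e g).2

theorem runs_countProg {r : SetReg} (hn : n ≤ B) (h : Represents e K s v t a) :
    Runs B (countProg r t.length) s fun s' =>
      Represents e K s' v ((a.set r).ncard :: t) a := by
  refine .seq (.assign (runs_forElem hn (h.pushScratch 0)
    (fun V t' b => t' = (V ∩ a.set r).ncard :: t ∧ a = b) (by simp) ?_ ?_))
  · rintro V g hg s t' b - ⟨rfl, rfl⟩ hs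
    have : Finite G := .of_equiv _ e.symm
    have hmem : (Expr.get (ArrSlot.set r) (.var (VarSlot.elem .x₁))).eval s ≠ 0 ↔ g ∈ a.set r := by
      simpa using hs.eval_mem .x₁ r
    refine .cond (fun hc => .assign ⟨_, a, by rfl, ⟨?_, rfl⟩, hs.setScratch_third _⟩)
      fun hc => .skip ⟨_, a, by rfl, ⟨?_, rfl⟩, hs⟩
    · have hcount : s.var (VarSlot.scratch t.length) = (V ∩ a.set r).ncard := hs.pop.pop.top
      rw [Set.insert_inter_of_mem (hmem.1 hc), Set.ncard_insert_of_notMem (fun h' => hg h'.1)]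
      simp [Expr.eval, hcount]
    · rw [Set.insert_inter_of_notMem fun h' => hmem.2 h' hc]
  · rintro s t' b - ⟨rfl, rfl⟩ hs
    rwa [Set.univ_inter] at hs

theorem runs_emitElementsProg {r : SetReg} {N : Subgroup G} (hn : n ≤ B)
    (h : Represents e K s v t a) (hN : (N : Set G) = a.set r) :
    Runs B (emitElementsProg r t.length) s fun s' =>
      ∃ o, ListsElements e N o ∧ Represents e K s' v t (a.addOut o) := by
  refine runs_forElem hn h (fun V t' b => t = t' ∧ ∃ o : List ℕ, b = a.addOut o ∧ o.Nodup ∧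
    ∀ i, i ∈ o ↔ ∃ g ∈ V ∩ a.set r, (e g : ℕ) = i) ⟨rfl, [], by simp [Store.addOut], by simp⟩ ?_ ?_
  · rintro V g hg s t' b - ⟨rfl, o, rfl, hnodup, ho⟩ hs
    have hmem : (Expr.get (ArrSlot.set r) (.var (VarSlot.elem .x₁))).eval s ≠ 0 ↔ g ∈ a.set r := by
      simpa using hs.eval_mem .x₁ r
    have heval : (Expr.var (VarSlot.elem .x₁)).eval s = e g := by simpa using hs.eval_elem .x₁
    refine .cond (fun hc => .emit ⟨t, _, rfl, ⟨rfl, o ++ [(e g : ℕ)], rfl, ?_, ?_⟩, ?_⟩)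
      fun hc => .skip ⟨t, _, rfl, ⟨rfl, o, rfl, hnodup, ?_⟩, hs⟩
    · rw [← List.concat_eq_append]
      refine hnodup.concat fun hi => ?_
      obtain ⟨k, hk, hkg⟩ := (ho _).1 hi
      exact hg (e.injective (Fin.ext hkg) ▸ hk.1)
    · intro i
      rw [Set.insert_inter_of_mem (hmem.1 hc), List.mem_append, ho]
      simp [or_comm, eq_comm]
    · rw [heval]
      simpa [Store.addOut] using hs.addOut [(e g : ℕ)]
    · rwa [Set.insert_inter_of_notMem fun h' => hmem.2 h' hc]
  · rintro s t' b - ⟨rfl, o, rfl, hnodup, ho⟩ hs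
    exact ⟨o, ⟨hnodup, by simpa [← hN] using ho⟩, hs⟩

theorem runs_forL {C : Cmd} {l : ListReg} {r : SetReg} {Ψ : Store G → Prop} (hn : n ≤ B)
    (hpos : 0 < n) (h : Represents e K s v t a) (hwp : (forL l r C).wp e K B Ψ v a)
    (hC : ∀ {Φ s t a}, Represents e K s v t a → C.wp e K B Φ v a →
      Runs B (C.prog t.length) s fun s' => ∃ b, Represents e K s' v t b ∧ Φ b) :
    Runs B ((forL l r C).prog t.length) s fun s' => ∃ b, Represents e K s' v t b ∧ Ψ b := by
  obtain ⟨hnodup, hlen, I, hI0, hI, hend⟩ := hwp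
  refine .seq (.assign (.loop _ hlen (fun i s => ∃ b, Represents e K s v (i * n :: t) b ∧
    I {N | N ∈ (a.list l).take i} b) ?_ ?_ ?_))
  · exact ⟨a, by simpa [Expr.eval] using h.pushScratch 0, by simpa using hI0⟩
  · rintro i hi s ⟨b, hs, hb⟩
    obtain ⟨heq, hstep⟩ := hI {N | N ∈ (a.list l).take i} (fun N => List.mem_of_mem_take) b hb
    refine ⟨?_, .seq ((runs_loadProg hn (heq ▸ hi) hs).mono fun s' hs' => .seq ?_)⟩
    · simp only [Expr.eval, hs.len, hs.top, heq]
      exact (Nat.sub_pos_of_lt (Nat.mul_lt_mul_of_pos_right hi hpos)).ne'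
    · have hvisited : insert (a.list l)[i] {N | N ∈ (a.list l).take i} =
          {N | N ∈ (a.list l).take (i + 1)} := by
        ext N
        simp only [List.take_succ_eq_append_getElem hi, Set.mem_insert_iff, Set.mem_ofPred_eq,
          List.mem_append, List.mem_singleton, or_comm]
      have hnext := hstep (a.list l)[i] (List.getElem_mem hi) fun hmem => by
        obtain ⟨j, hj, hji⟩ := List.mem_take_iff_getElem.1 hmem
        have := hnodup.getElem_inj_iff.1 hji
        omega
      simp only [heq, hvisited] at hs' hnext
      refine (hC hs' hnext).mono fun s'' ⟨c, hs'', hc⟩ => .assign ⟨c, ?_, hc⟩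
      simpa [Expr.eval, hs''.top, hs''.size, add_mul] using hs''.pop.pushScratch ((i + 1) * n)
  · rintro s ⟨b, hs, hb⟩
    rw [List.take_length] at hb
    have heq := (hI _ subset_rfl b hb).1
    exact ⟨by simp [Expr.eval, hs.len, heq, hs.top], b, hs.pop, hend b hb⟩

theorem runs (C : Cmd) {Ψ : Store G → Prop} (hn : n ≤ B) (hpos : 0 < n) (hK : K ≤ B)
    (h : Represents e K s v t a) (hwp : C.wp e K B Ψ v a) :
    Runs B (C.prog t.length) s fun s' => ∃ b, Represents e K s' v t b ∧ Ψ b := by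
  induction C generalizing Ψ s v t a with
  | skip => exact .skip ⟨a, h, hwp⟩
  | seq C D ihC ihD => exact .seq ((ihC h hwp).mono fun s' ⟨b, hs, hb⟩ => ihD hs hb)
  | ite φ C D ihC ihD =>
    refine .seq ((φ.runs hn h).mono fun s' ⟨r, hs, hr⟩ => ?_)
    have htest : (Expr.var (VarSlot.scratch t.length)).eval s' = r := hs.top
    exact .cond (fun hc => ihC hs.pop (hwp.1 (hr.1 (htest ▸ hc))))
      fun hc => ihD hs.pop (hwp.2 fun hφ => hr.2 hφ (htest ▸ hc))
  | add x r | del x r =>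
    refine .store ⟨_, ?_, hwp⟩
    rw [h.eval_elem]
    exact h.setSet (by simp [Expr.eval]) fun k hk => by simp [hk]
  | forE x C ih =>
    obtain ⟨I, hI0, hI, hend⟩ := hwp
    refine runs_forElem hn h (fun V t' b => t' = t ∧ I V b) ⟨rfl, hI0⟩ ?_ ?_
    · rintro V g hg s t' b - ⟨rfl, hb⟩ hs
      exact (ih hs (hI V g hg b hb)).mono fun s' ⟨c, hs', hc⟩ => ⟨t', c, rfl, ⟨rfl, hc⟩, hs'⟩
    · rintro s t' b - ⟨rfl, hb⟩ hs
      exact ⟨b, hs, hend b hb⟩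
  | rep C ih =>
    obtain ⟨I, hI0, hI, hend⟩ := hwp
    refine .countTo K hK h.iter (by simp) (fun i s => ∃ b, Represents e K s v t b ∧ I i b) ?_ ?_ ?_
    · exact ⟨a, h.setScratch le_rfl 0, hI0⟩
    · rintro i hi s hc - ⟨b, hs, hb⟩
      refine (ih (hs.push hc) (hI i hi b hb)).mono fun s' ⟨c, hs', hc'⟩ => ?_
      exact ⟨hs'.top, by simpa using hs'.iter, c, hs'.pop.setScratch le_rfl _, hc'⟩
    · rintro s ⟨b, hs, hb⟩
      exact ⟨b, hs, hend b hb⟩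
  | forL l r C ih => exact runs_forL hn hpos h hwp ih
  | push l r =>
    obtain ⟨N, hN, hΨ⟩ := hwp
    exact (runs_pushProg hn h hN).mono fun s' hs' => ⟨_, hs', hΨ⟩
  | nil l => exact .assign ⟨_, h.nil l, hwp⟩
  | emit r =>
    obtain ⟨N, hN, hΨ⟩ := hwp
    refine .seq ((runs_countProg hn h).mono fun s' hs => .seq (.emit ?_))
    refine (runs_emitElementsProg hn (hs.addOut [_]) hN).mono fun s'' ⟨o, ho, hs''⟩ => ?_
    refine ⟨_, hs''.pop, ?_⟩
    have hcount : (a.set r).ncard = o.length := by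
      rw [← hN, ho.length_eq]
    have htest : (Expr.var (VarSlot.scratch t.length)).eval s' = o.length := hcount ▸ hs.top
    simpa [Store.addOut, htest] using hΨ o ho

end Cmd
end

/-! ## Reasoning about commands -/

namespace Cmd

/-- The set variables that are modified by a command. -/
def sets : Cmd → List SetReg
  | seq C D | ite _ C D => C.sets ++ D.sets
  | add _ r | del _ r => [r]
  | forE _ C | rep C => C.sets
  | forL _ r C => r :: C.sets
  | skip | push _ _ | nil _ | emit _ => []

/-- The list variables that are modified by a command. -/
def lists : Cmd → List ListReg
  | seq C D | ite _ C D => C.lists ++ D.lists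
  | forE _ C | rep C | forL _ _ C => C.lists
  | push l _ | nil l => [l]
  | skip | add _ _ | del _ _ | emit _ => []

/-- Whether a command writes to the output. -/
def emits : Cmd → Bool
  | seq C D | ite _ C D => C.emits || D.emits
  | forE _ C | rep C | forL _ _ C => C.emits
  | emit _ => true
  | skip | add _ _ | del _ _ | push _ _ | nil _ => false

variable {G : Type*} [Group G] {n : ℕ} {e : G ≃ Fin n} {K B : ℕ} {C D : Cmd}
  {Φ Ψ : Store G → Prop} {v : ElemReg → G} {a b c : Store G}

/-- The stores `a` and `b` differ only in what is modified by the command `C`. -/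
structure Frame (C : Cmd) (a b : Store G) : Prop where
  set : ∀ r ∉ C.sets, b.set r = a.set r
  list : ∀ l ∉ C.lists, b.list l = a.list l
  out : C.emits = false → b.out = a.out

namespace Frame

theorem refl : C.Frame a a := ⟨fun _ _ => rfl, fun _ _ => rfl, fun _ => rfl⟩

theorem trans (h : C.Frame a b) (h' : C.Frame b c) : C.Frame a c :=
  ⟨fun r hr => (h'.set r hr).trans (h.set r hr), fun l hl => (h'.list l hl).trans (h.list l hl),
    fun he => (h'.out he).trans (h.out he)⟩

theorem mono (h : C.Frame a b) (hsets : C.sets ⊆ D.sets) (hlists : C.lists ⊆ D.lists)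
    (hemits : C.emits → D.emits) : D.Frame a b :=
  ⟨fun r hr => h.set r fun h' => hr (hsets h'), fun l hl => h.list l fun h' => hl (hlists h'),
    fun he => h.out (by simpa [he] using hemits)⟩

theorem setSet {r : SetReg} {S : Set G} (hr : r ∈ C.sets) : C.Frame a (a.setSet r S) :=
  ⟨fun _ hq => Function.update_of_ne (ne_of_mem_of_not_mem hr hq).symm _ _, fun _ _ => rfl,
    fun _ => rfl⟩

theorem setList {l : ListReg} {L : List (Subgroup G)} (hl : l ∈ C.lists) :
    C.Frame a (a.setList l L) :=
  ⟨fun _ _ => rfl, fun _ hq => Function.update_of_ne (ne_of_mem_of_not_mem hl hq).symm _ _,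
    fun _ => rfl⟩

end Frame

theorem wp_mono (hΦ : ∀ b, Φ b → Ψ b) (h : C.wp e K B Φ v a) : C.wp e K B Ψ v a := by
  induction C generalizing v a Φ Ψ with
  | skip | add x r | del x r | nil l => exact hΦ _ h
  | seq C D ihC ihD => exact ihC (fun _ => ihD hΦ) h
  | ite φ C D ihC ihD => exact ⟨fun hφ => ihC hΦ (h.1 hφ), fun hφ => ihD hΦ (h.2 hφ)⟩
  | forE x C | rep C =>
    obtain ⟨I, h0, hstep, hend⟩ := h
    exact ⟨I, h0, hstep, fun b hb => hΦ b (hend b hb)⟩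
  | forL l r C =>
    obtain ⟨hnodup, hlen, I, h0, hstep, hend⟩ := h
    exact ⟨hnodup, hlen, I, h0, hstep, fun b hb => hΦ b (hend b hb)⟩
  | push l r =>
    obtain ⟨N, hN, hN'⟩ := h
    exact ⟨N, hN, hΦ _ hN'⟩
  | emit r =>
    obtain ⟨N, hN, hN'⟩ := h
    exact ⟨N, hN, fun o ho => hΦ _ (hN' o ho)⟩

theorem wp_frame (h : C.wp e K B Φ v a) : C.wp e K B (fun b => C.Frame a b ∧ Φ b) v a := by
  induction C generalizing v a Φ with
  | skip => exact ⟨.refl, h⟩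
  | add x r | del x r => exact ⟨.setSet (by simp [sets]), h⟩
  | nil l => exact ⟨.setList (by simp [lists]), h⟩
  | seq C D ihC ihD =>
    suffices C.wp e K B (D.wp e K B (fun c => (seq C D).Frame a c ∧ Φ c) v) v a from this
    refine wp_mono (fun b hb => wp_mono (fun c hc => ⟨?_, hc.2⟩) (ihD hb.2)) (ihC h)
    exact (hb.1.mono (by simp [sets]) (by simp [lists]) (by simp +contextual [emits])).trans
      (hc.1.mono (by simp [sets]) (by simp [lists]) (by simp +contextual [emits]))
  | ite φ C D ihC ihD =>
    exact ⟨fun hφ => wp_mono (fun b hb => ⟨hb.1.mono (by simp [sets]) (by simp [lists])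
        (by simp +contextual [emits]), hb.2⟩) (ihC (h.1 hφ)),
      fun hφ => wp_mono (fun b hb => ⟨hb.1.mono (by simp [sets]) (by simp [lists])
        (by simp +contextual [emits]), hb.2⟩) (ihD (h.2 hφ))⟩
  | forE x C ih =>
    obtain ⟨I, h0, hstep, hend⟩ := h
    refine ⟨fun V b => (forE x C).Frame a b ∧ I V b, ⟨.refl, h0⟩, fun V g hg b hb => ?_,
      fun b hb => ⟨hb.1, hend b hb.2⟩⟩
    exact wp_mono (fun c hc => ⟨hb.1.trans ⟨hc.1.set, hc.1.list, hc.1.out⟩, hc.2⟩)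
      (ih (hstep V g hg b hb.2))
  | rep C ih =>
    obtain ⟨I, h0, hstep, hend⟩ := h
    refine ⟨fun i b => (rep C).Frame a b ∧ I i b, ⟨.refl, h0⟩, fun i hi b hb => ?_,
      fun b hb => ⟨hb.1, hend b hb.2⟩⟩
    exact wp_mono (fun c hc => ⟨hb.1.trans ⟨hc.1.set, hc.1.list, hc.1.out⟩, hc.2⟩)
      (ih (hstep i hi b hb.2))
  | forL l r C ih =>
    obtain ⟨hnodup, hlen, I, h0, hstep, hend⟩ := h
    refine ⟨hnodup, hlen, fun V b => (forL l r C).Frame a b ∧ I V b, ⟨.refl, h0⟩,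
      fun V hV b hb => ⟨(hstep V hV b hb.2).1, fun N hN hNV => ?_⟩,
      fun b hb => ⟨hb.1, hend b hb.2⟩⟩
    refine wp_mono (fun c hc => ⟨hb.1.trans (.trans (.setSet (by simp [sets])) (hc.1.mono
      (by simp [sets]) (by simp [lists]) (by simp [emits]))), hc.2⟩)
      (ih ((hstep V hV b hb.2).2 N hN hNV))
  | push l r =>
    obtain ⟨N, hN, hN'⟩ := h
    exact ⟨N, hN, .setList (by simp [lists]), hN'⟩
  | emit r =>
    obtain ⟨N, hN, hN'⟩ := h
    exact ⟨N, hN, fun o ho => ⟨⟨fun _ _ => rfl, fun _ _ => rfl, by simp [emits]⟩, hN' o ho⟩⟩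

theorem wp_of_wp (h : C.wp e K B Ψ v a) (hΦ : ∀ b, C.Frame a b → Ψ b → Φ b) :
    C.wp e K B Φ v a :=
  wp_mono (fun b hb => hΦ b hb.1 hb.2) (wp_frame h)

theorem wp_seq (hC : C.wp e K B Ψ v a) (hD : ∀ b, C.Frame a b → Ψ b → D.wp e K B Φ v b) :
    (seq C D).wp e K B Φ v a :=
  show C.wp e K B (D.wp e K B Φ v) v a from wp_of_wp hC hD

theorem wp_forE {x : ElemReg} (I : Set G → Store G → Prop) (h0 : I ∅ a)
    (hstep : ∀ V, ∀ g ∉ V, ∀ b, (forE x C).Frame a b → I V b →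
      C.wp e K B (I (Insert.insert g V)) (Function.update v x g) b) :
    (forE x C).wp e K B (I Set.univ) v a := by
  refine ⟨fun V b => (forE x C).Frame a b ∧ I V b, ⟨.refl, h0⟩, fun V g hg b hb => ?_,
    fun b hb => hb.2⟩
  exact wp_of_wp (hstep V g hg b hb.1 hb.2) fun c hc hI =>
    ⟨hb.1.trans ⟨hc.set, hc.list, hc.out⟩, hI⟩

theorem wp_rep (I : ℕ → Store G → Prop) (h0 : I 0 a)
    (hstep : ∀ i < K, ∀ b, (rep C).Frame a b → I i b → C.wp e K B (I (i + 1)) v b) :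
    (rep C).wp e K B (I K) v a := by
  refine ⟨fun i b => (rep C).Frame a b ∧ I i b, ⟨.refl, h0⟩, fun i hi b hb => ?_,
    fun b hb => hb.2⟩
  exact wp_of_wp (hstep i hi b hb.1 hb.2) fun c hc hI =>
    ⟨hb.1.trans ⟨hc.set, hc.list, hc.out⟩, hI⟩

/-- The list `L` has the members of the family `𝒱`, each of them once. -/
def Lists (𝒱 : Set (Subgroup G)) (L : List (Subgroup G)) : Prop :=
  L.Nodup ∧ ∀ N, N ∈ L ↔ N ∈ 𝒱

theorem Lists.nil : Lists (∅ : Set (Subgroup G)) [] := ⟨List.nodup_nil, by simp⟩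

theorem Lists.concat {𝒱 : Set (Subgroup G)} {L : List (Subgroup G)} (h : Lists 𝒱 L)
    {N : Subgroup G} (hN : N ∉ 𝒱) : Lists (insert N 𝒱) (L ++ [N]) := by
  refine ⟨List.nodup_append.2 ⟨h.1, List.nodup_singleton N, ?_⟩, fun M => ?_⟩
  · rintro M hM _ hN' rfl
    exact hN ((h.2 N).1 (List.mem_singleton.1 hN' ▸ hM))
  · simp [h.2, or_comm]

theorem Lists.length_eq {𝒱 : Set (Subgroup G)} {L : List (Subgroup G)} (h : Lists 𝒱 L) :
    L.length = 𝒱.ncard := by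
  classical
  have h𝒱 : 𝒱 = L.toFinset := by ext; simp [h.2]
  rw [h𝒱, Set.ncard_coe_finset, List.toFinset_card_of_nodup h.1]

theorem wp_forL {l : ListReg} {r : SetReg} {𝒱 : Set (Subgroup G)} (h : Lists 𝒱 (a.list l))
    (hB : 𝒱.ncard ≤ B) (hl : l ∉ C.lists) (I : Set (Subgroup G) → Store G → Prop) (h0 : I ∅ a)
    (hstep : ∀ V ⊆ 𝒱, ∀ N ∈ 𝒱, N ∉ V → ∀ b, (forL l r C).Frame a b → I V b →
      C.wp e K B (I (insert N V)) v (b.setSet r N)) :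
    (forL l r C).wp e K B (I 𝒱) v a := by
  obtain rfl : {N | N ∈ a.list l} = 𝒱 := Set.ext h.2
  refine ⟨h.1, h.length_eq.trans_le hB, fun V b => (forL l r C).Frame a b ∧ I V b, ⟨.refl, h0⟩,
    fun V hV b hb => ⟨hb.1.list l hl, fun N hN hNV => ?_⟩, fun b hb => hb.2⟩
  refine wp_of_wp (hstep V hV N hN hNV b hb.1 hb.2) fun c hc hI => ⟨hb.1.trans ?_, hI⟩
  exact .trans (.setSet (by simp [sets])) (hc.mono (by simp [sets]) (by simp [lists])
    (by simp [emits]))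

end Cmd

/-! ## Cyclic and simple sections of a group -/

section

open scoped commutatorElement

variable {G : Type*} [Group G] {H N P Q : Subgroup G}

/-- `N` is a normal subgroup of `H`. -/
def NormalIn (N H : Subgroup G) : Prop :=
  N ≤ H ∧ ∀ h ∈ H, ∀ x ∈ N, h * x * h⁻¹ ∈ N

/-- `N` is normal in `H` with cyclic quotient. -/
def CyclicIn (N H : Subgroup G) : Prop :=
  NormalIn N H ∧ ∃ x ∈ H, H ≤ N ⊔ Subgroup.zpowers x

/-- `N` is normal in `H` with simple quotient. -/
def SimpleIn (N H : Subgroup G) : Prop :=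
  NormalIn N H ∧ N ≠ H ∧ ∀ K, NormalIn K H → N ≤ K → K = N ∨ K = H

theorem normalIn_iff : NormalIn N H ↔ N ≤ H ∧ (N.subgroupOf H).Normal := by
  refine and_congr_right fun hN => ⟨fun h => ⟨?_⟩, fun h x hx y hy => ?_⟩
  · rintro ⟨x, hx⟩ hxN ⟨g, hg⟩
    exact h g hg x hxN
  · exact h.conj_mem ⟨y, hN hy⟩ hy ⟨x, hx⟩

theorem normalIn_self (H : Subgroup G) : NormalIn H H :=
  ⟨le_rfl, fun _ hh _ hx => H.mul_mem (H.mul_mem hh hx) (H.inv_mem hh)⟩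

theorem NormalIn.sup (hN : NormalIn N H) (hP : NormalIn P H) : NormalIn (N ⊔ P) H := by
  have := (normalIn_iff.1 hN).2
  have := (normalIn_iff.1 hP).2
  refine normalIn_iff.2 ⟨sup_le hN.1 hP.1, ?_⟩
  rw [Subgroup.subgroupOf_sup hN.1 hP.1]
  infer_instance

theorem normalIn_of_commutator_le (h1 : ⁅H, H⁆ ≤ N) (h2 : N ≤ H) : NormalIn N H := by
  refine ⟨h2, fun h hh x hx => ?_⟩
  rw [show h * x * h⁻¹ = ⁅h, x⁆ * x by simp [commutatorElement_def]]
  exact N.mul_mem (h1 (Subgroup.commutator_mem_commutator hh (h2 hx))) hx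

theorem commutator_le_iff : ⁅H, H⁆ ≤ N ↔ commutator H ≤ N.subgroupOf H := by
  rw [← Subgroup.map_subtype_commutator, Subgroup.map_le_iff_le_comap]
  rfl

theorem subgroupOf_sup_zpowers (hN : N ≤ H) (x : H) :
    N.subgroupOf H ⊔ Subgroup.zpowers x = (N ⊔ Subgroup.zpowers (x : G)).subgroupOf H := by
  rw [Subgroup.subgroupOf_sup hN (by simp)]
  congr 1
  refine Subgroup.map_injective H.subtype_injective ?_
  rw [MonoidHom.map_zpowers, Subgroup.map_subgroupOf_eq_of_le (by simp), Subgroup.coe_subtype]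

theorem isCyclic_quotient_iff_exists_sup [N.Normal] :
    IsCyclic (G ⧸ N) ↔ ∃ x, N ⊔ Subgroup.zpowers x = ⊤ := by
  have hN := QuotientGroup.mk'_surjective N
  rw [isCyclic_iff_exists_zpowers_eq_top, hN.exists]
  refine exists_congr fun x => ?_
  rw [← QuotientGroup.comap_map_mk', MonoidHom.map_zpowers,
    ← (Subgroup.comap_injective hN).eq_iff, Subgroup.comap_top]

theorem isSimpleGroup_quotient_iff_forall_normal [N.Normal] :
    IsSimpleGroup (G ⧸ N) ↔ N ≠ ⊤ ∧ ∀ K : Subgroup G, K.Normal → N ≤ K → K = N ∨ K = ⊤ := by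
  have hN := QuotientGroup.mk'_surjective N
  rw [← QuotientGroup.nontrivial_iff]
  refine ⟨fun h => ⟨h.toNontrivial, fun K hK hNK => ?_⟩, fun h =>
    { toNontrivial := h.1, eq_bot_or_eq_top_of_normal := fun L hL => ?_ }⟩
  · have hcomap : (K.map (QuotientGroup.mk' N)).comap (QuotientGroup.mk' N) = K := by
      rw [QuotientGroup.comap_map_mk', sup_eq_right.2 hNK]
    rw [← hcomap]
    refine (h.eq_bot_or_eq_top_of_normal _ (hK.map _ hN)).imp (fun hL => ?_) (fun hL => ?_)
    · rw [hL, MonoidHom.comap_bot, QuotientGroup.ker_mk']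
    · rw [hL, Subgroup.comap_top]
  · have hNL : N ≤ L.comap (QuotientGroup.mk' N) :=
      (QuotientGroup.ker_mk' N).symm.le.trans (Subgroup.comap_mono bot_le)
    refine (h.2 _ inferInstance hNL).imp (fun hL => ?_) (fun hL => ?_)
    · refine Subgroup.comap_injective hN ?_
      rw [hL, MonoidHom.comap_bot, QuotientGroup.ker_mk']
    · exact Subgroup.comap_injective hN (hL.trans (Subgroup.comap_top _).symm)

theorem isCyclic_quotient_subgroupOf_iff (hN : N ≤ H) [(N.subgroupOf H).Normal] :
    IsCyclic (H ⧸ N.subgroupOf H) ↔ ∃ x ∈ H, H ≤ N ⊔ Subgroup.zpowers x := by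
  simp [isCyclic_quotient_iff_exists_sup, subgroupOf_sup_zpowers hN, Subgroup.subgroupOf_eq_top]

theorem isSimpleGroup_quotient_subgroupOf_iff (hN : N ≤ H) [(N.subgroupOf H).Normal] :
    IsSimpleGroup (H ⧸ N.subgroupOf H) ↔
      N ≠ H ∧ ∀ K, NormalIn K H → N ≤ K → K = N ∨ K = H := by
  have hinj : ∀ {K L : Subgroup G}, K ≤ H → L ≤ H →
      (K.subgroupOf H = L.subgroupOf H ↔ K = L) := fun hK hL => by
    rw [Subgroup.subgroupOf_inj, inf_eq_left.2 hK, inf_eq_left.2 hL]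
  rw [isSimpleGroup_quotient_iff_forall_normal, ← Subgroup.subgroupOf_self, Ne,
    hinj hN le_rfl]
  refine and_congr_right fun _ => ⟨fun h K hK hNK => ?_, fun h K hK hNK => ?_⟩
  · have := h _ (normalIn_iff.1 hK).2 (Subgroup.comap_mono hNK)
    rwa [hinj hK.1 hN, hinj hK.1 le_rfl] at this
  · obtain ⟨K, hKH, rfl⟩ : ∃ L ≤ H, L.subgroupOf H = K :=
      ⟨K.map H.subtype, Subgroup.map_subtype_le K,
        Subgroup.comap_map_eq_self_of_injective H.subtype_injective K⟩
    rw [hinj hKH hN, hinj hKH le_rfl]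
    exact h K (normalIn_iff.2 ⟨hKH, hK⟩) fun x hx => hNK (show ⟨x, hN hx⟩ ∈ N.subgroupOf H from hx)

theorem CyclicIn.isCyclic_quotient (h : CyclicIn N H) :
    ∃ _ : (N.subgroupOf H).Normal, IsCyclic (H ⧸ N.subgroupOf H) :=
  have hN := normalIn_iff.1 h.1
  ⟨hN.2, have := hN.2; (isCyclic_quotient_subgroupOf_iff hN.1).2 h.2⟩

theorem CyclicIn.commutator_le (h : CyclicIn N H) : ⁅H, H⁆ ≤ N := by
  obtain ⟨_, hcyclic⟩ := h.isCyclic_quotient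
  rw [commutator_le_iff, ← Subgroup.Normal.quotient_commutative_iff_commutator_le]
  exact IsCyclic.isMulCommutative

theorem CyclicIn.inf (h : CyclicIn N H) (hP : P ≤ H) : CyclicIn (N ⊓ P) P := by
  obtain ⟨_, hcyclic⟩ := h.isCyclic_quotient
  let f := (QuotientGroup.mk' (N.subgroupOf H)).comp (Subgroup.inclusion hP)
  have hf : f.ker = (N ⊓ P).subgroupOf P := by
    ext x
    simp [f, MonoidHom.mem_ker, Subgroup.mem_subgroupOf]
  have hnormal : ((N ⊓ P).subgroupOf P).Normal := hf ▸ f.normal_ker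
  refine ⟨normalIn_iff.2 ⟨inf_le_right, hnormal⟩,
    (isCyclic_quotient_subgroupOf_iff inf_le_right).1 ?_⟩
  exact (QuotientGroup.quotientMulEquivOfEq hf).isCyclic.1
    (isCyclic_of_injective _ (QuotientGroup.kerLift_injective f))

theorem exists_inf_sup_zpowers_eq (N : Subgroup G) (hD : ⁅H, H⁆ ≤ Q) (hQ : Q ≤ H) {g : G}
    (hg : g ∈ H) : ∃ y ∈ Q ⊔ Subgroup.zpowers g,
      N ⊓ (Q ⊔ Subgroup.zpowers g) = (N ⊓ Q) ⊔ Subgroup.zpowers y := by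
  have hle : Q ⊔ Subgroup.zpowers g ≤ H := sup_le hQ (by simpa using hg)
  have hcyclic : CyclicIn Q (Q ⊔ Subgroup.zpowers g) :=
    ⟨⟨le_sup_left, fun k hk => (normalIn_of_commutator_le hD hQ).2 k (hle hk)⟩, g,
      (le_sup_right : _ ≤ Q ⊔ _) (Subgroup.mem_zpowers g), le_rfl⟩
  obtain ⟨-, y, hy, hP⟩ := hcyclic.inf (P := N ⊓ (Q ⊔ Subgroup.zpowers g)) inf_le_right
  refine ⟨y, hy.2, le_antisymm (hP.trans (sup_le_sup_right ?_ _)) (sup_le ?_ ?_)⟩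
  · exact le_inf (inf_le_right.trans inf_le_left) inf_le_left
  · exact inf_le_inf le_rfl le_sup_left
  · simpa using hy

theorem SimpleIn.cyclicIn_of_commutator_le (h : SimpleIn N H) (hD : ⁅H, H⁆ ≤ N) :
    CyclicIn N H := by
  obtain ⟨x, hx, hxN⟩ := SetLike.exists_of_lt (lt_of_le_of_ne h.1.1 h.2.1)
  have hle : N ⊔ Subgroup.zpowers x ≤ H := sup_le h.1.1 (by simpa using hx)
  have heq := (h.2.2 _ (normalIn_of_commutator_le (hD.trans le_sup_left) hle)
    le_sup_left).resolve_left fun h' =>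
      hxN (h'.le ((le_sup_right : _ ≤ N ⊔ _) (Subgroup.mem_zpowers x)))
  exact ⟨h.1, x, hx, heq.ge⟩

/-! ## Closures under conjugation -/

/-- The smallest subgroup that contains `S` and is invariant under conjugation by `H`. For `S ⊆ H`,
this is the normal closure of `S` in `H`. -/
def conjClosure (H : Subgroup G) (S : Set G) : Subgroup G :=
  sInf {K | S ⊆ K ∧ ∀ h ∈ H, ∀ x ∈ K, h * x * h⁻¹ ∈ K}

variable {S T : Set G} {x y : G}

theorem subset_conjClosure : S ⊆ conjClosure H S := fun x hx => by
  simp only [conjClosure, SetLike.mem_coe, Subgroup.mem_sInf]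
  exact fun K hK => hK.1 hx

theorem conj_mem_conjClosure {h : G} (hh : h ∈ H) (hx : x ∈ conjClosure H S) :
    h * x * h⁻¹ ∈ conjClosure H S := by
  simp only [conjClosure, Subgroup.mem_sInf] at hx ⊢
  exact fun K hK => hK.2 h hh x (hx K hK)

theorem conjClosure_le (hS : S ⊆ P) (hP : ∀ h ∈ H, ∀ x ∈ P, h * x * h⁻¹ ∈ P) :
    conjClosure H S ≤ P :=
  sInf_le ⟨hS, hP⟩

theorem normalIn_conjClosure (hS : S ⊆ H) : NormalIn (conjClosure H S) H :=
  ⟨conjClosure_le hS (normalIn_self H).2, fun _ hh _ hx => conj_mem_conjClosure hh hx⟩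

theorem normalIn_conjClosure_singleton (hx : x ∈ H) : NormalIn (conjClosure H {x}) H :=
  normalIn_conjClosure (Set.singleton_subset_iff.2 hx)

theorem mem_conjClosure_singleton : x ∈ conjClosure H {x} :=
  subset_conjClosure rfl

theorem conjClosure_singleton_le (hP : NormalIn P H) (hx : x ∈ P) : conjClosure H {x} ≤ P :=
  conjClosure_le (Set.singleton_subset_iff.2 hx) hP.2

theorem conjClosure_eq_self (hN : NormalIn N H) : conjClosure H (N : Set G) = N :=
  le_antisymm (conjClosure_le subset_rfl hN.2) subset_conjClosure

theorem conjClosure_insert_le (hP : NormalIn P H) (hN : N ≤ P) (hy : y ∈ P) :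
    conjClosure H (insert y (N : Set G)) ≤ P :=
  conjClosure_le (Set.insert_subset hy hN) hP.2

theorem le_conjClosure_insert : N ≤ conjClosure H (insert y (N : Set G)) :=
  fun _ hx => subset_conjClosure (Set.mem_insert_of_mem _ hx)

theorem mem_conjClosure_insert : y ∈ conjClosure H (insert y S) :=
  subset_conjClosure (Set.mem_insert _ _)

/-- The elements obtained from members of `S` by a single multiplication, or by a single conjugation
by an element of `H`, and the neutral element. Closing `S` under this operation gives
`conjClosure H S`. -/
def generationStep (H : Subgroup G) (S : Set G) : Set G :=
  {g | g = 1 ∨ (∃ x ∈ S, ∃ y ∈ S, x * y = g) ∨ ∃ h ∈ H, ∃ x ∈ S, h * x * h⁻¹ = g}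

theorem generationStep_mono (hST : S ⊆ T) : generationStep H S ⊆ generationStep H T := by
  rintro g (rfl | ⟨x, hx, y, hy, rfl⟩ | ⟨h, hh, x, hx, rfl⟩)
  · exact .inl rfl
  · exact .inr (.inl ⟨x, hST hx, y, hST hy, rfl⟩)
  · exact .inr (.inr ⟨h, hh, x, hST hx, rfl⟩)

theorem generationStep_conjClosure_subset :
    generationStep H (conjClosure H S : Set G) ⊆ conjClosure H S := by
  rintro g (rfl | ⟨x, hx, y, hy, rfl⟩ | ⟨h, hh, x, hx, rfl⟩)
  · exact one_mem _
  · exact mul_mem hx hy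
  · exact conj_mem_conjClosure hh hx

theorem eq_conjClosure_of_generationStep_subset [Finite G] (hST : S ⊆ T)
    (hT : T ⊆ conjClosure H S) (hclosed : generationStep H T ⊆ T) : T = conjClosure H S := by
  let M : Submonoid G :=
    ⟨⟨T, fun hx hy => hclosed (.inr (.inl ⟨_, hx, _, hy, rfl⟩))⟩, hclosed (.inl rfl)⟩
  have inv_mem : ∀ {x}, x ∈ M → x⁻¹ ∈ M := fun {x} hx => Submonoid.powers_le.2 hx
    (mem_powers_iff_mem_zpowers.2 (inv_mem (Subgroup.mem_zpowers x)))
  exact Set.Subset.antisymm hT (conjClosure_le (P := { M with inv_mem' := inv_mem }) hST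
    fun h hh x hx => hclosed (.inr (.inr ⟨h, hh, x, hx, rfl⟩)))

theorem conjClosure_insert_eq_sup (hD : ⁅H, H⁆ ≤ N) (hN : N ≤ H) (hy : y ∈ H) :
    conjClosure H (insert y (N : Set G)) = N ⊔ Subgroup.zpowers y := by
  have hle : N ⊔ Subgroup.zpowers y ≤ H := sup_le hN (by simpa using hy)
  refine le_antisymm (conjClosure_insert_le (normalIn_of_commutator_le (hD.trans le_sup_left) hle)
    le_sup_left ?_) (sup_le le_conjClosure_insert ?_)
  · exact (le_sup_right : _ ≤ N ⊔ _) (Subgroup.mem_zpowers y)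
  · simpa using mem_conjClosure_insert

theorem conjClosure_commutators :
    conjClosure H {g | ∃ a ∈ H, ∃ b ∈ H, a * b = g * (b * a)} = ⁅H, H⁆ := by
  have eq_commutator : ∀ a b g : G, a * b = g * (b * a) ↔ ⁅a, b⁆ = g := fun a b g => by
    rw [commutatorElement_def, ← mul_inv_eq_iff_eq_mul, mul_inv_rev, ← mul_assoc]
  simp only [eq_commutator]
  refine le_antisymm (conjClosure_le ?_ (normalIn_of_commutator_le le_rfl H.commutator_le_self).2)
    (Subgroup.commutator_le.2 fun a ha b hb => subset_conjClosure ⟨a, ha, b, hb, rfl⟩)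
  rintro _ ⟨a, ha, b, hb, rfl⟩
  exact Subgroup.commutator_mem_commutator ha hb

/-! ## Cyclic sections -/

/-- The subgroups of `Q` with cyclic quotient that contain the commutator subgroup of `H`. For
`Q = H` these are all subgroups `N` with `CyclicIn N H`. -/
def cyclicFamily (H Q : Subgroup G) : Set (Subgroup G) := {N | ⁅H, H⁆ ≤ N ∧ CyclicIn N Q}

theorem cyclicFamily_self (H : Subgroup G) : cyclicFamily H H = {N | CyclicIn N H} :=
  Set.ext fun _ => ⟨And.right, fun h => ⟨h.commutator_le, h⟩⟩

theorem cyclicFamily_commutator (H : Subgroup G) : cyclicFamily H ⁅H, H⁆ = {⁅H, H⁆} := by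
  ext N
  refine ⟨fun h => le_antisymm h.2.1.1 h.1, ?_⟩
  rintro rfl
  exact ⟨le_rfl, normalIn_self _, 1, one_mem _, le_sup_left⟩

theorem cyclicIn_iff_exists_conjClosure_eq (hD : ⁅H, H⁆ ≤ N) (hN : N ≤ Q) (hQ : Q ≤ H) :
    CyclicIn N Q ↔ ∃ x ∈ Q, conjClosure H (insert x (N : Set G)) = Q := by
  have hNQ : NormalIn N Q :=
    ⟨hN, fun h hh => (normalIn_of_commutator_le hD (hN.trans hQ)).2 h (hQ hh)⟩
  rw [CyclicIn, and_iff_right hNQ]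
  refine exists_congr fun x => and_congr_right fun hx => ?_
  rw [conjClosure_insert_eq_sup hD (hN.trans hQ) (hQ hx)]
  exact ⟨fun h => le_antisymm (sup_le hN (by simpa using hx)) h, fun h => h.ge⟩

-- A member `M` of the larger family is generated by `M ⊓ Q` and a single element.
theorem iUnion_cyclicFamily_eq (hD : ⁅H, H⁆ ≤ Q) (hQ : Q ≤ H) {g : G} (hg : g ∈ H) :
    (⋃ N ∈ cyclicFamily H Q, ⋃ y : G, {M | M = N ⊔ Subgroup.zpowers y ∧
      y ∈ Q ⊔ Subgroup.zpowers g ∧ CyclicIn M (Q ⊔ Subgroup.zpowers g)}) =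
      cyclicFamily H (Q ⊔ Subgroup.zpowers g) := by
  ext M
  simp only [Set.mem_iUnion]
  constructor
  · rintro ⟨N, hN, y, rfl, -, hM⟩
    exact ⟨hN.1.trans le_sup_left, hM⟩
  · rintro ⟨hDM, hM⟩
    obtain ⟨y, hy, hMy⟩ := exists_inf_sup_zpowers_eq M hD hQ hg
    rw [inf_eq_left.2 hM.1.1] at hMy
    refine ⟨M ⊓ Q, ⟨le_inf hDM hD, ?_⟩, y, hMy, hy, hM⟩
    exact hM.inf le_sup_left

/-! ## Nonabelian simple sections -/

theorem SimpleIn.conjClosure_insert (h : SimpleIn N H) (hy : y ∈ H) (hyN : y ∉ N) :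
    conjClosure H (insert y (N : Set G)) = H :=
  (h.2.2 _ (normalIn_conjClosure (Set.insert_subset hy h.1.1))
    le_conjClosure_insert).resolve_left fun h' => hyN (h' ▸ mem_conjClosure_insert)

theorem SimpleIn.sup_eq (h : SimpleIn N H) (hP : NormalIn P H) (hPN : ¬ P ≤ N) : N ⊔ P = H :=
  (h.2.2 _ (h.1.sup hP) le_sup_left).resolve_left fun h' => hPN (h' ▸ le_sup_right)

theorem commutator_le_of_inf_le [N.Normal] [P.Normal] [Q.Normal] (hP : N ⊔ P = ⊤)
    (hQ : N ⊔ Q = ⊤) (h : P ⊓ Q ≤ N) : commutator G ≤ N := by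
  have hmap : ∀ K, N ⊔ K = ⊤ → K.map (QuotientGroup.mk' N) = ⊤ := fun K hK =>
    Subgroup.comap_injective (QuotientGroup.mk'_surjective N)
      (by rw [QuotientGroup.comap_map_mk', hK, Subgroup.comap_top])
  have hbot : (⁅P, Q⁆).map (QuotientGroup.mk' N) = ⊥ := by
    rw [Subgroup.map_eq_bot_iff, QuotientGroup.ker_mk']
    exact (Subgroup.commutator_le_inf P Q).trans h
  have htop : (commutator G).map (QuotientGroup.mk' N) = ⊥ := by
    rw [commutator_def, Subgroup.map_commutator, ← MonoidHom.range_eq_map, QuotientGroup.range_mk',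
      ← hbot, Subgroup.map_commutator, hmap P hP, hmap Q hQ]
  rwa [Subgroup.map_eq_bot_iff, QuotientGroup.ker_mk'] at htop

theorem SimpleIn.not_inf_le (h : SimpleIn N H) (hD : ¬ ⁅H, H⁆ ≤ N) (hP : NormalIn P H)
    (hPN : ¬ P ≤ N) (hQ : NormalIn Q H) (hQN : ¬ Q ≤ N) : ¬ P ⊓ Q ≤ N := by
  intro hPQ
  have := (normalIn_iff.1 h.1).2
  have := (normalIn_iff.1 hP).2
  have := (normalIn_iff.1 hQ).2
  refine hD (commutator_le_iff.2 (commutator_le_of_inf_le (P := P.subgroupOf H)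
    (Q := Q.subgroupOf H) ?_ ?_ ?_))
  · rw [← Subgroup.subgroupOf_sup h.1.1 hP.1, h.sup_eq hP hPN, Subgroup.subgroupOf_self]
  · rw [← Subgroup.subgroupOf_sup h.1.1 hQ.1, h.sup_eq hQ hQN, Subgroup.subgroupOf_self]
  · exact fun x hx => hPQ hx

/-- The elements of `H` whose normal closure in `H` does not contain `x`. -/
def avoiding (H : Subgroup G) (x : G) : Set G := {y | y ∈ H ∧ x ∉ conjClosure H {y}}

-- The element `x` is chosen outside `N` with the smallest possible normal closure.
theorem SimpleIn.eq_avoiding [Finite G] (h : SimpleIn N H) (hD : ¬ ⁅H, H⁆ ≤ N) :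
    ∃ x ∈ H, (N : Set G) = avoiding H x := by
  obtain ⟨x₀, hx₀⟩ := SetLike.exists_of_lt (lt_of_le_of_ne h.1.1 h.2.1)
  obtain ⟨x, ⟨hx, hxN⟩, hmin⟩ := Set.exists_min_image {x | x ∈ H ∧ x ∉ N}
    (fun x => Nat.card (conjClosure H {x})) (Set.toFinite _) ⟨x₀, hx₀⟩
  refine ⟨x, hx, Set.ext fun y => ⟨fun hy => ⟨h.1.1 hy, fun hxy => hxN ?_⟩, ?_⟩⟩
  · exact conjClosure_singleton_le h.1 hy hxy
  rintro ⟨hy, hxy⟩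
  by_contra hyN
  have hPx := normalIn_conjClosure_singleton hx
  have hPy := normalIn_conjClosure_singleton hy
  obtain ⟨z, ⟨hzx, hzy⟩, hzN⟩ := SetLike.not_le_iff_exists.1 (h.not_inf_le hD hPx
    (fun h' => hxN (h' mem_conjClosure_singleton)) hPy
    (fun h' => hyN (h' mem_conjClosure_singleton)))
  have heq : conjClosure H {z} = conjClosure H {x} :=
    Subgroup.eq_of_le_of_card_ge (conjClosure_singleton_le hPx hzx) (hmin z ⟨hPx.1 hzx, hzN⟩)
  exact hxy (conjClosure_singleton_le hPy hzy (heq ▸ mem_conjClosure_singleton))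

theorem simpleIn_iff_of_eq_avoiding (hx : x ∈ H) (hN : (N : Set G) = avoiding H x) :
    SimpleIn N H ↔
      NormalIn N H ∧ ∀ y ∈ H, y ∈ N ∨ conjClosure H (insert y (N : Set G)) = H := by
  refine ⟨fun h => ⟨h.1, fun y hy => or_iff_not_imp_left.2 (h.conjClosure_insert hy)⟩,
    fun h => ⟨h.1, ?_, fun K hK hle => ?_⟩⟩
  · rintro rfl
    exact (hN.subset hx).2 mem_conjClosure_singleton
  · by_cases hKN : K ≤ N
    · exact .inl (le_antisymm hKN hle)
    · obtain ⟨y, hy, hyN⟩ := SetLike.not_le_iff_exists.1 hKN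
      refine .inr (le_antisymm hK.1 ?_)
      rw [← (h.2 y (hK.1 hy)).resolve_left hyN]
      exact conjClosure_insert_le hK hle hy

end

/-! ## Descending series -/

section

variable {G : Type*} [Group G] {H N : Subgroup G}

/-- `N` is normal in `H` with cyclic or simple quotient. -/
def SectionStep (H N : Subgroup G) : Prop := CyclicIn N H ∨ SimpleIn N H

/-- The subgroups reached from `G` by descending series of length `i` with cyclic or simple
factors. -/
def seriesLevel (G : Type*) [Group G] : ℕ → Set (Subgroup G)
  | 0 => {⊤}
  | i + 1 => {N | ∃ H ∈ seriesLevel G i, SectionStep H N}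

theorem exists_unit_character [Finite G] (h : CyclicIn N H) :
    ∃ χ : H →* ℂˣ, χ.ker = N.subgroupOf H := by
  obtain ⟨_, hcyclic⟩ := h.isCyclic_quotient
  have hne : NeZero (Nat.card (H ⧸ N.subgroupOf H)) := ⟨Nat.card_pos.ne'⟩
  let f := mulEquivOfCyclicCardEq (G := H ⧸ N.subgroupOf H)
    (G' := rootsOfUnity (Nat.card (H ⧸ N.subgroupOf H)) ℂ) (Complex.card_rootsOfUnity _).symm
  refine ⟨(Subgroup.subtype _).comp (f.toMonoidHom.comp (QuotientGroup.mk' _)), ?_⟩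
  ext x
  simp [MonoidHom.mem_ker]

theorem card_unit_character_le (A : Type*) [Group A] [Finite A] :
    Finite (A →* ℂˣ) ∧ Nat.card (A →* ℂˣ) ≤ Nat.card A := by
  have hcard : Nat.card (A →* ℂˣ) = Nat.card (Abelianization A) := by
    rw [Nat.card_congr Abelianization.lift,
      CommGroup.card_monoidHom_of_hasEnoughRootsOfUnity (Abelianization A) ℂ]
  exact ⟨Nat.finite_of_card_ne_zero (hcard ▸ Nat.card_pos.ne'),
    hcard.trans_le (Nat.card_le_card_of_surjective _ (QuotientGroup.mk'_surjective _))⟩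

theorem ncard_cyclicIn_le [Finite G] (H : Subgroup G) :
    {N | CyclicIn N H}.ncard ≤ Nat.card H := by
  obtain ⟨hfinite, hcard⟩ := card_unit_character_le H
  choose χ hχ using fun N : {N | CyclicIn N H} => exists_unit_character N.2
  have hinj : Function.Injective χ := by
    intro N N' hNN
    have h : (N : Subgroup G).subgroupOf H = (N' : Subgroup G).subgroupOf H := by
      rw [← hχ, ← hχ, hNN]
    rw [Subgroup.subgroupOf_inj, inf_eq_left.2 N.2.1.1, inf_eq_left.2 N'.2.1.1] at h
    exact Subtype.ext h
  exact (Nat.card_le_card_of_injective χ hinj).trans hcard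

theorem ncard_cyclicFamily_le [Finite G] (H Q : Subgroup G) :
    (cyclicFamily H Q).ncard ≤ Nat.card G :=
  (Set.ncard_le_ncard fun _ hN => hN.2).trans
    ((ncard_cyclicIn_le Q).trans (Subgroup.card_le_card_group Q))

theorem setOf_sectionStep_eq [Finite G] (H : Subgroup G) : {N | SectionStep H N} =
    {N | CyclicIn N H} ∪ ⋃ x, {N | x ∈ H ∧ SimpleIn N H ∧ (N : Set G) = avoiding H x} := by
  ext N
  simp only [Set.mem_union, Set.mem_iUnion]
  constructor
  · rintro (hN | hN)
    · exact .inl hN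
    · by_cases hD : ⁅H, H⁆ ≤ N
      · exact .inl (hN.cyclicIn_of_commutator_le hD)
      · obtain ⟨x, hx, hNx⟩ := hN.eq_avoiding hD
        exact .inr ⟨x, hx, hN, hNx⟩
  · rintro (hN | ⟨x, -, hN, -⟩)
    exacts [.inl hN, .inr hN]

theorem ncard_sectionStep_le [Finite G] (H : Subgroup G) :
    {N | SectionStep H N}.ncard ≤ 2 * Nat.card G := by
  have hsub : (⋃ x, {N | x ∈ H ∧ SimpleIn N H ∧ (N : Set G) = avoiding H x}) ⊆
      {N | (N : Set G) ∈ Set.range (avoiding H)} :=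
    Set.iUnion_subset fun x N hN => ⟨x, hN.2.2.symm⟩
  have havoiding : {N : Subgroup G | (N : Set G) ∈ Set.range (avoiding H)}.ncard ≤ Nat.card G := by
    calc _ ≤ (Set.range (avoiding H)).ncard :=
          Set.ncard_le_ncard_of_injOn (fun N : Subgroup G => (N : Set G)) (fun N hN => hN)
            (fun _ _ _ _ h => SetLike.coe_injective h) (Set.toFinite _)
      _ ≤ (Set.univ : Set G).ncard := by
          rw [← Set.image_univ]; exact Set.ncard_image_le (Set.toFinite _)
      _ = Nat.card G := Set.ncard_univ G
  have hcyclic := (ncard_cyclicIn_le H).trans (Subgroup.card_le_card_group H)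
  rw [setOf_sectionStep_eq]
  calc _ ≤ _ := Set.ncard_union_le _ _
    _ ≤ _ := Nat.add_le_add_left (Set.ncard_le_ncard hsub (Set.toFinite _)) _
    _ ≤ _ := by omega

theorem ncard_seriesLevel_le [Finite G] (i : ℕ) :
    (seriesLevel G i).ncard ≤ (2 * Nat.card G) ^ i := by
  classical
  induction i with
  | zero => simp [seriesLevel]
  | succ i ih =>
    let level : Finset (Subgroup G) := (Set.toFinite (seriesLevel G i)).toFinset
    let steps : Subgroup G → Finset (Subgroup G) :=
      fun H => (Set.toFinite {N | SectionStep H N}).toFinset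
    have hsucc : seriesLevel G (i + 1) = level.biUnion steps := by
      ext N; simp [seriesLevel, level, steps]
    rw [hsucc, Set.ncard_coe_finset, pow_succ]
    refine (Finset.card_biUnion_le_card_mul level steps (2 * Nat.card G) fun H _ => ?_).trans ?_
    · rw [← Set.ncard_eq_toFinset_card]
      exact ncard_sectionStep_le H
    · rw [← Set.ncard_eq_toFinset_card]
      exact Nat.mul_le_mul_right _ ih

theorem SectionStep.normalIn (h : SectionStep H N) : NormalIn N H :=
  h.elim And.left And.left

theorem sectionStep_iff_isCyclicOrSimple (hN : NormalIn N H) [(N.subgroupOf H).Normal] :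
    SectionStep H N ↔ IsCyclicOrSimple (H ⧸ N.subgroupOf H) := by
  rw [SectionStep, CyclicIn, SimpleIn, and_iff_right hN, and_iff_right hN, IsCyclicOrSimple,
    isCyclic_quotient_subgroupOf_iff hN.1, isSimpleGroup_quotient_subgroupOf_iff hN.1]

theorem sectionStep_iff : SectionStep H N ↔ N ≤ H ∧ ∃ _ : (N.subgroupOf H).Normal,
    IsCyclicOrSimple (H ⧸ N.subgroupOf H) := by
  refine ⟨fun h => ?_, fun ⟨hN, hnormal, h⟩ =>
    (sectionStep_iff_isCyclicOrSimple (normalIn_iff.2 ⟨hN, hnormal⟩)).2 h⟩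
  obtain ⟨hN, hnormal⟩ := normalIn_iff.1 h.normalIn
  exact ⟨hN, hnormal, (sectionStep_iff_isCyclicOrSimple h.normalIn).1 h⟩

theorem isCyclicOrSimple_congr {A A' : Type*} [Group A] [Group A'] (f : A ≃* A') :
    IsCyclicOrSimple A ↔ IsCyclicOrSimple A' :=
  or_congr f.isCyclic f.isSimpleGroup_congr

section

variable {G' : Type*} [Group G'] {f : G →* G'} {H' N' : Subgroup G'}

theorem normalIn_comap_iff (hf : Function.Surjective f) :
    NormalIn (N'.comap f) (H'.comap f) ↔ NormalIn N' H' := by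
  refine and_congr (Subgroup.comap_le_comap_of_surjective hf) ?_
  simp [hf.forall, Subgroup.mem_comap]

theorem sectionStep_comap_iff (hf : Function.Surjective f) :
    SectionStep (H'.comap f) (N'.comap f) ↔ SectionStep H' N' := by
  suffices key : NormalIn N' H' → (SectionStep (H'.comap f) (N'.comap f) ↔ SectionStep H' N') from
    ⟨fun h => (key ((normalIn_comap_iff hf).1 h.normalIn)).1 h, fun h => (key h.normalIn).2 h⟩
  intro hN
  have hN' := (normalIn_comap_iff hf).2 hN
  have := (normalIn_iff.1 hN).2
  have := (normalIn_iff.1 hN').2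
  rw [sectionStep_iff_isCyclicOrSimple hN, sectionStep_iff_isCyclicOrSimple hN']
  let g := (QuotientGroup.mk' (N'.subgroupOf H')).comp (f.subgroupComap H')
  have hg : Function.Surjective g := (QuotientGroup.mk'_surjective _).comp
    (f.subgroupComap_surjective_of_surjective H' hf)
  have hker : (N'.comap f).subgroupOf (H'.comap f) = g.ker := by
    ext x
    simp only [g, MonoidHom.mem_ker, MonoidHom.comp_apply, QuotientGroup.mk'_apply,
      QuotientGroup.eq_one_iff, Subgroup.mem_subgroupOf]
    rfl
  exact isCyclicOrSimple_congr ((QuotientGroup.quotientMulEquivOfEq hker).trans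
    (QuotientGroup.quotientKerEquivOfSurjective g hg))

end

theorem mem_seriesLevel_iff (A : Subgroup G) (k : ℕ) : A ∈ seriesLevel G k ↔
    ∃ M : ℕ → Subgroup G, M 0 = ⊤ ∧ M k = A ∧ ∀ i < k, SectionStep (M i) (M (i + 1)) := by
  induction k generalizing A with
  | zero => exact ⟨fun hA => ⟨fun _ => ⊤, rfl, hA.symm, by simp⟩,
      fun ⟨M, htop, hA, _⟩ => hA.symm.trans htop⟩
  | succ k ih =>
    constructor
    · rintro ⟨H, hH, hA⟩
      obtain ⟨M, htop, hMk, hM⟩ := (ih H).1 hH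
      refine ⟨fun i => if i ≤ k then M i else A, by simpa using htop, by simp, fun i hi => ?_⟩
      rcases Nat.lt_succ_iff_lt_or_eq.1 hi with hik | rfl
      · simpa [hik, hik.le] using hM i hik
      · simpa [hMk] using hA
    · rintro ⟨M, htop, rfl, hM⟩
      exact ⟨M k, (ih _).2 ⟨M, htop, rfl, fun i hi => hM i (by omega)⟩, hM k (by omega)⟩

theorem le_of_forall_succ_le {M : ℕ → Subgroup G} {k : ℕ} (hM : ∀ i < k, M (i + 1) ≤ M i) {i : ℕ}
    (hi : i ≤ k) : M k ≤ M i := by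
  induction k, hi using Nat.le_induction with
  | base => exact le_rfl
  | succ k _ ih => exact (hM k k.lt_succ_self).trans (ih fun i hi => hM i (by omega))

theorem hasCyclicOrSimpleSeries_quotient_iff (A : Subgroup G) [A.Normal] (k : ℕ) :
    HasCyclicOrSimpleSeries (G ⧸ A) k ↔ A ∈ seriesLevel G k := by
  have hf := QuotientGroup.mk'_surjective A
  rw [mem_seriesLevel_iff]
  simp only [HasCyclicOrSimpleSeries, ← sectionStep_iff]
  constructor
  · rintro ⟨N, htop, hbot, hN⟩
    refine ⟨fun i => (N i).comap (QuotientGroup.mk' A), by simp [htop], ?_, fun i hi =>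
      (sectionStep_comap_iff hf).2 (hN i hi)⟩
    simp only [hbot, MonoidHom.comap_bot, QuotientGroup.ker_mk']
  · rintro ⟨M, htop, rfl, hM⟩
    have hcomap : ∀ i ≤ k, ((M i).map (QuotientGroup.mk' (M k))).comap (QuotientGroup.mk' (M k))
        = M i := fun i hi => by
      rw [QuotientGroup.comap_map_mk', sup_eq_right]
      exact le_of_forall_succ_le (fun i hi => (sectionStep_iff.1 (hM i hi)).1) hi
    refine ⟨fun i => (M i).map (QuotientGroup.mk' (M k)), ?_, by simp, fun i hi => ?_⟩
    · simpa only [htop] using Subgroup.map_top_of_surjective _ hf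
    · rw [← sectionStep_comap_iff hf, hcomap i hi.le, hcomap (i + 1) hi]
      exact hM i hi

theorem hasCyclicOrSimpleSeries_one_iff (A : Subgroup G) [A.Normal] :
    HasCyclicOrSimpleSeries (G ⧸ A) 1 ↔ IsCyclicOrSimple (G ⧸ A) := by
  have hone : A ∈ seriesLevel G 1 ↔ SectionStep ⊤ A := by simp [seriesLevel]
  have hnormal : (A.subgroupOf ⊤).Normal := inferInstance
  rw [hasCyclicOrSimpleSeries_quotient_iff, hone,
    sectionStep_iff_isCyclicOrSimple (normalIn_iff.2 ⟨le_top, hnormal⟩)]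
  refine isCyclicOrSimple_congr (QuotientGroup.congr _ _ Subgroup.topEquiv ?_)
  ext x
  simp [Subgroup.mem_map, Subgroup.mem_subgroupOf]

end

/-! ## Programs for subsets -/

namespace Cmd

open Fml

/-- Compute in the set variable `r` the set of the values of `x` for which `φ` holds after `C`. -/
def collect (x : ElemReg) (r : SetReg) (C : Cmd) (φ : Fml) : Cmd :=
  forE x (seq C (ite φ (add x r) (del x r)))

/-- Compute in the set variable `r` the set of the values of `x₁` that satisfy `φ`. -/
def define (r : SetReg) (φ : Fml) : Cmd := collect .x₁ r skip φ

/-- The value of `x₁` lies in the `generationStep` of the set `r` for the subgroup `group`. -/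
def isGenerated (r : SetReg) : Fml :=
  or (mul .x₁ .x₁ .x₁) <|
  or (ex .x₂ (ex .x₃ (and (mem .x₂ r) (and (mem .x₃ r) (mul .x₂ .x₃ .x₁))))) <|
  ex .x₂ (ex .x₃ (ex .x₄ (and (mem .x₂ .group) (and (mem .x₃ r)
    (and (mul .x₂ .x₃ .x₄) (mul .x₁ .x₂ .x₄))))))

/-- Add to the set `r` the members of its `generationStep`. -/
def grow (r : SetReg) : Cmd := forE .x₁ (ite (isGenerated r) (add .x₁ r) skip)

/-- Replace the set `r` by its `conjClosure`. -/
def close (r : SetReg) : Cmd := forE .x₂ (grow r)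

/-- Compute in the set variable `r` the `conjClosure` of the values of `x₁` that satisfy `φ`. -/
def generate (r : SetReg) (φ : Fml) : Cmd := seq (define r φ) (close r)

/-- Compute the set of the members of `q` that generate `q` together with `target`. -/
def generators (q : SetReg) : Cmd :=
  collect .member .generators (generate .closure (or (mem .x₁ .target) (eq .x₁ .member)))
    (and (mem .member q) (eqSet .closure q))

variable {G : Type*} [Group G] {n : ℕ} {e : G ≃ Fin n} {K B : ℕ} {v : ElemReg → G} {a : Store G}
  {r : SetReg} {φ : Fml} {H : Subgroup G}

theorem wp_collect {x : ElemReg} {C : Cmd} (S : Set G) (hr : r ∉ C.sets)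
    (hC : ∀ g b, (collect x r C φ).Frame a b → C.wp e K B
      (fun c => φ.Sat (Function.update v x g) c.set ↔ g ∈ S) (Function.update v x g) b) :
    (collect x r C φ).wp e K B (fun b => b.set r = S) v a := by
  refine wp_mono (fun b hb => Set.ext fun g => hb g (Set.mem_univ g)) (wp_forE
    (fun V b => ∀ g ∈ V, g ∈ b.set r ↔ g ∈ S) (by simp) fun V g hg b hab hb =>
      wp_seq (hC g b hab) fun c hbc hc => ?_)
  have of_mem : ∀ h ∈ V, h ≠ g ∧ (h ∈ c.set r ↔ h ∈ S) := fun h hh =>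
    ⟨ne_of_mem_of_not_mem hh hg, by rw [hbc.set r hr, hb h hh]⟩
  refine ⟨fun hφ => ?_, fun hφ => ?_⟩ <;> rw [hc] at hφ <;> rintro h (rfl | hh)
  · simp [hφ]
  · simp [of_mem h hh]
  · simp [hφ]
  · simp [of_mem h hh]

theorem wp_define (S : Set G) (hφ : ∀ g, ∀ b, (define r φ).Frame a b →
      (φ.Sat (Function.update v .x₁ g) b.set ↔ g ∈ S)) :
    (define r φ).wp e K B (fun b => b.set r = S) v a :=
  wp_collect S (by simp [sets]) hφ

theorem sat_isGenerated (h : a.set .group = H) :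
    (isGenerated r).Sat v a.set ↔ v .x₁ ∈ generationStep H (a.set r) := by
  simp only [isGenerated, sat_or, sat_mul, sat_ex, sat_and, sat_mem, generationStep, h]
  refine or_congr (by simp) (or_congr (by simp) ?_)
  simp [mul_inv_eq_iff_eq_mul, eq_comm (a := v .x₁ * _)]

theorem wp_grow {S : Set G} (hr : r ≠ .group) (hH : a.set .group = H)
    (hS : a.set r ⊆ conjClosure H S) :
    (grow r).wp e K B (fun b => a.set r ∪ generationStep H (a.set r) ⊆ b.set r ∧
      b.set r ⊆ conjClosure H S) v a := by
  refine wp_mono (fun b hb => ⟨Set.union_subset hb.1 (by simpa using hb.2.2), hb.2.1⟩) (wp_forE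
    (fun V b => a.set r ⊆ b.set r ∧ b.set r ⊆ conjClosure H S ∧
      V ∩ generationStep H (a.set r) ⊆ b.set r) ⟨subset_rfl, hS, by simp⟩
    fun V g _ b hab ⟨hab', hbS, hV⟩ => ?_)
  have hb : b.set .group = H := (hab.set .group (by simp [sets, hr.symm])).trans hH
  refine ⟨fun hg => ?_, fun hg => ?_⟩ <;>
    rw [sat_isGenerated hb, Function.update_self] at hg
  · simp only [wp, Function.update_self, Store.set_setSet]
    refine ⟨hab'.trans (Set.subset_insert _ _), Set.insert_subset ?_ hbS, ?_⟩
    · exact generationStep_conjClosure_subset (generationStep_mono hbS hg)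
    · rintro h ⟨rfl | hh, hh'⟩
      · exact Set.mem_insert _ _
      · exact Set.mem_insert_of_mem _ (hV ⟨hh, hh'⟩)
  · refine ⟨hab', hbS, ?_⟩
    rintro h ⟨rfl | hh, hh'⟩
    · exact absurd (generationStep_mono hab' hh') hg
    · exact hV ⟨hh, hh'⟩

-- A set of elements grows strictly at most as often as the group has elements.
theorem wp_close (hr : r ≠ .group) (hH : a.set .group = H) :
    (close r).wp e K B (fun b => b.set r = conjClosure H (a.set r)) v a := by
  have hfin : Finite G := .of_equiv _ e.symm
  refine wp_mono (fun b hb => ?_) (wp_forE (fun V b => a.set r ⊆ b.set r ∧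
    b.set r ⊆ conjClosure H (a.set r) ∧ (b.set r = conjClosure H (a.set r) ∨
      V.ncard ≤ (b.set r).ncard)) ⟨subset_rfl, subset_conjClosure, by simp⟩
    fun V g hg b hab ⟨hab', hb, hV⟩ => ?_)
  · obtain ⟨-, hb, h | h⟩ := hb
    · exact h
    · exact Set.eq_of_subset_of_ncard_le hb
        ((Set.ncard_le_ncard (Set.subset_univ _) Set.finite_univ).trans h)
  · have hgroup : b.set .group = H :=
      (hab.set .group (by simp [sets, grow, hr.symm])).trans hH
    refine wp_mono (fun c hc => ?_) (wp_grow hr hgroup hb)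
    have hbc : b.set r ⊆ c.set r := Set.subset_union_left.trans hc.1
    refine ⟨hab'.trans hbc, hc.2, ?_⟩
    by_cases h : c.set r = b.set r
    · refine .inl (h ▸ eq_conjClosure_of_generationStep_subset hab' hb ?_)
      exact Set.subset_union_right.trans (h ▸ hc.1)
    · refine hV.imp (fun h' => hc.2.antisymm (h'.symm.trans_subset hbc)) fun h' => ?_
      rw [Set.ncard_insert_of_notMem hg]
      exact h'.trans_lt (Set.ncard_lt_ncard (hbc.ssubset_of_ne (Ne.symm h)))

theorem wp_generate (S : Set G) (hr : r ≠ .group) (hH : a.set .group = H)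
    (hφ : ∀ g, ∀ b, (define r φ).Frame a b → (φ.Sat (Function.update v .x₁ g) b.set ↔ g ∈ S)) :
    (generate r φ).wp e K B (fun b => b.set r = conjClosure H S) v a := by
  refine wp_seq (wp_define S hφ) fun b hab hb => hb ▸ wp_close hr ?_
  rw [hab.set .group (by simp [sets, define, collect, hr.symm]), hH]

theorem sets_generate : (generate r φ).sets = [r, r, r] := rfl

theorem sets_generators {q : SetReg} : (generators q).sets =
    [.closure, .closure, .closure, .generators, .generators] := rfl

theorem wp_generators {q : SetReg} (hq : q ≠ .closure ∧ q ≠ .generators)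
    (hH : a.set .group = H) :
    (generators q).wp e K B (fun b => b.set .generators =
      {x | x ∈ a.set q ∧ (conjClosure H (insert x (a.set .target)) : Set G) = a.set q}) v a := by
  refine wp_collect _ (by decide) fun g b (hab : (generators q).Frame a b) => ?_
  refine wp_of_wp (wp_generate (H := H) (insert g (a.set .target)) (by decide)
    ((hab.set .group (by simp [sets_generators])).trans hH) fun x c hbc => ?_) fun c hbc hc => ?_
  · simp [hbc.set .target (by decide), hab.set .target (by simp [sets_generators]), or_comm]
  · have hcq : c.set q = a.set q := by
      rw [hbc.set q (by simp [sets_generate, hq]),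
        hab.set q (by simp [sets_generators, hq])]
    simp only [sat_and, sat_mem, sat_eqSet, Function.update_self, hcq, hc]
    rfl

end Cmd

/-! ## Programs for lists of subgroups -/

namespace Cmd

open Fml

/-- Append the subgroup `r` to the list `l` unless it is there already. The value of `x₁` only
serves as a flag: it is put into `found` if `r` is on the list. -/
def pushNew (l : ListReg) (r : SetReg) : Cmd :=
  seq (del .x₁ .found) <|
  seq (forL l .listed (ite (eqSet r .listed) (add .x₁ .found) skip)) <|
  ite (mem .x₁ .found) skip (push l r)

/-- Append the subgroup `r` to the list `l` if `φ` holds and it is not there already. -/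
def pushNewIf (φ : Fml) (l : ListReg) (r : SetReg) : Cmd := ite φ (pushNew l r) skip

/-- Replace the list `dst` by the list `src`. -/
def copy (src dst : ListReg) : Cmd :=
  seq (nil dst) (forL src .target (pushNew dst .target))

variable {G : Type*} [Group G] {n : ℕ} {e : G ≃ Fin n} {K B : ℕ} {C D : Cmd}
  {Φ : Store G → Prop} {v : ElemReg → G} {a b : Store G} {l l' : ListReg} {r : SetReg} {φ : Fml}
  {𝒱 𝒩 𝒩' : Set (Subgroup G)} {N : Subgroup G}

variable (e K B) in
/-- The command `C` adds the members of the family `𝒩` to the list `l`, as long as the list does not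
become longer than `B`. -/
def Adds (C : Cmd) (l : ListReg) (𝒩 : Set (Subgroup G)) (v : ElemReg → G) (a : Store G) : Prop :=
  ∀ 𝒲, Lists 𝒲 (a.list l) → (𝒲 ∪ 𝒩).ncard ≤ B →
    C.wp e K B (fun b => Lists (𝒲 ∪ 𝒩) (b.list l)) v a

namespace Adds

theorem of_seq (hC : C.wp e K B Φ v a) (hl : l ∉ C.lists)
    (hD : ∀ b, C.Frame a b → Φ b → D.Adds e K B l 𝒩 v b) : (seq C D).Adds e K B l 𝒩 v a :=
  fun 𝒲 h𝒲 hB => wp_seq hC fun b hab hb => hD b hab hb 𝒲 (by rwa [hab.list l hl]) hB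

theorem seq (hC : C.Adds e K B l 𝒩 v a) (hD : ∀ b, C.Frame a b → D.Adds e K B l 𝒩' v b) :
    (seq C D).Adds e K B l (𝒩 ∪ 𝒩') v a := fun 𝒲 h𝒲 hB => by
  have hfin : Finite G := .of_equiv _ e.symm
  rw [← Set.union_assoc] at hB ⊢
  exact wp_seq (hC 𝒲 h𝒲 ((Set.ncard_le_ncard Set.subset_union_left).trans hB))
    fun b hab hb => hD b hab _ hb hB

theorem forE {x : ElemReg} (f : G → Set (Subgroup G))
    (h : ∀ g b, (forE x C).Frame a b → C.Adds e K B l (f g) (Function.update v x g) b) :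
    (forE x C).Adds e K B l (⋃ g, f g) v a := fun 𝒲 h𝒲 hB => by
  have hfin : Finite G := .of_equiv _ e.symm
  rw [← Set.biUnion_univ] at hB ⊢
  refine wp_forE (fun V b => Lists (𝒲 ∪ ⋃ g ∈ V, f g) (b.list l)) (by simpa using h𝒲)
    fun V g _ b hab hb => ?_
  rw [Set.biUnion_insert, Set.union_comm (f g), ← Set.union_assoc]
  refine h g b hab _ hb ((Set.ncard_le_ncard ?_).trans hB)
  exact Set.union_subset (Set.union_subset_union_right _ (Set.biUnion_mono (Set.subset_univ V)
    fun _ _ => subset_rfl))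
    ((Set.subset_biUnion_of_mem (Set.mem_univ g)).trans Set.subset_union_right)

theorem forL (f : Subgroup G → Set (Subgroup G)) (h𝒱 : Lists 𝒱 (a.list l)) (hB𝒱 : 𝒱.ncard ≤ B)
    (hl : l ∉ C.lists) (h : ∀ N ∈ 𝒱, ∀ b, (forL l r C).Frame a b → b.set r = N →
      C.Adds e K B l' (f N) v b) :
    (forL l r C).Adds e K B l' (⋃ N ∈ 𝒱, f N) v a := fun 𝒲 h𝒲 hB => by
  have hfin : Finite G := .of_equiv _ e.symm
  refine wp_forL h𝒱 hB𝒱 hl (fun V b => Lists (𝒲 ∪ ⋃ N ∈ V, f N) (b.list l')) (by simpa using h𝒲)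
    fun V hV N hN _ b hab hb => ?_
  rw [Set.biUnion_insert, Set.union_comm (f N), ← Set.union_assoc]
  refine h N hN _ (hab.trans (.setSet (by simp [sets]))) (by simp) _ hb
    ((Set.ncard_le_ncard ?_).trans hB)
  exact Set.union_subset (Set.union_subset_union_right _ (Set.biUnion_mono hV
    fun _ _ => subset_rfl)) ((Set.subset_biUnion_of_mem hN).trans Set.subset_union_right)

theorem pushNew (hr : r ≠ .found ∧ r ≠ .listed) (hN : a.set r = N) :
    (pushNew l r).Adds e K B l {N} v a := fun 𝒲 h𝒲 hB => by
  have hfin : Finite G := .of_equiv _ e.symm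
  refine wp_seq (C := del .x₁ .found) (Ψ := fun b => v .x₁ ∉ b.set .found) (by simp [wp])
    fun b hab hb => ?_
  have hbl : b.list l = a.list l := hab.list l (by simp [lists])
  refine wp_seq (wp_forL (hbl ▸ h𝒲) ((Set.ncard_le_ncard Set.subset_union_left).trans hB)
    (by simp [lists]) (fun V c => v .x₁ ∈ c.set .found ↔ N ∈ V) (by simpa using hb)
    fun V _ M _ _ c hbc hc => ?_) fun c hbc hc => ?_
  · have hcr : c.set r = N := by
      rw [hbc.set r (by simp [sets, hr]), hab.set r (by simp [sets, hr]), hN]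
    refine ⟨fun h => ?_, fun h => ?_⟩ <;>
      simp only [sat_eqSet, Store.set_setSet, Function.update_self, Function.update_of_ne hr.2, hcr,
        SetLike.coe_set_eq] at h
    · simp [wp, h]
    · simp [wp, h, hc]
  · have hcl : c.list l = a.list l := (hbc.list l (by simp [lists])).trans hbl
    have hcr : c.set r = N := by
      rw [hbc.set r (by simp [sets, hr]), hab.set r (by simp [sets, hr]), hN]
    refine ⟨fun h => ?_, fun h => ⟨N, hcr.symm, ?_⟩⟩ <;> rw [sat_mem, hc] at h
    · simpa [wp, hcl, Set.insert_eq_of_mem h] using h𝒲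
    · simpa [hcl] using h𝒲.concat h

theorem pushNewIf (hr : r ≠ .found ∧ r ≠ .listed)
    (hφ : φ.Sat v a.set → ∃ N : Subgroup G, a.set r = N)
    (h𝒩 : ∀ N, N ∈ 𝒩 ↔ φ.Sat v a.set ∧ a.set r = N) :
    (pushNewIf φ l r).Adds e K B l 𝒩 v a := fun 𝒲 h𝒲 hB => by
  refine ⟨fun h => ?_, fun h => ?_⟩
  · obtain ⟨N, hN⟩ := hφ h
    obtain rfl : 𝒩 = {N} := by ext; simp [h𝒩, h, hN, eq_comm]
    exact pushNew hr hN 𝒲 h𝒲 hB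
  · obtain rfl : 𝒩 = ∅ := by ext; simp [h𝒩, h]
    simpa [wp] using h𝒲

theorem forL_pushNew {src : ListReg} (hr : r ≠ .found ∧ r ≠ .listed) (hl : src ≠ l)
    (h𝒱 : Lists 𝒱 (a.list src)) (hB : 𝒱.ncard ≤ B) :
    (Cmd.forL src r (Cmd.pushNew l r)).Adds e K B l 𝒱 v a := by
  simpa using forL (fun N => {N}) h𝒱 hB (by simpa [lists, Cmd.pushNew] using hl)
    fun N _ b _ hb => pushNew hr hb

end Adds

theorem wp_copy {src dst : ListReg} (h : src ≠ dst) (h𝒱 : Lists 𝒱 (a.list src))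
    (hB : 𝒱.ncard ≤ B) : (copy src dst).wp e K B (fun b => Lists 𝒱 (b.list dst)) v a := by
  refine wp_seq (C := nil dst) (Ψ := fun b => Lists ∅ (b.list dst)) (by simp [wp, Lists.nil])
    fun b hab hb => ?_
  simpa using Adds.forL_pushNew (e := e) (K := K) (v := v) (r := .target) (by decide) h
    (hab.list src (by simpa [lists] using h) ▸ h𝒱) hB ∅ hb (by simpa using hB)

end Cmd

/-! ## Programs for cyclic sections -/

namespace Cmd

open Fml

/-- Add the subgroup generated by `kernel` and `generator` to the list `nextCyclic` if it is a
subgroup of `stage` with cyclic quotient. -/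
def candidate : Cmd :=
  seq (generate .target (or (mem .x₁ .kernel) (eq .x₁ .generator))) <|
  seq (generators .stage) <|
  pushNewIf (and (mem .generator .stage) (ex .x₁ (mem .x₁ .generators))) .nextCyclic .target

/-- Add the members of the `cyclicFamily` of `stage` to the list `nextCyclic`, given the list
`cyclic` of the members for the previous stage. -/
def extend : Cmd := forL .cyclic .kernel (forE .generator candidate)

/-- Enlarge the subgroup `stage` by the element `step`, and replace the list `cyclic` of its
subgroups with cyclic quotient accordingly. -/
def enlarge : Cmd :=
  seq (seq (add .step .stage) (close .stage)) <|
  seq (nil .nextCyclic) <|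
  seq extend <|
  copy .nextCyclic .cyclic

/-- The value of `x₁` is a commutator of members of `group`. -/
def isCommutator : Fml :=
  ex .x₂ <| ex .x₃ <| and (mem .x₂ .group) <| and (mem .x₃ .group) <|
  ex .x₄ <| ex .x₅ <| and (mul .x₂ .x₃ .x₄) <| and (mul .x₃ .x₂ .x₅) (mul .x₁ .x₅ .x₄)

/-- Compute the list `cyclic` of the normal subgroups of `group` with cyclic quotient. -/
def cyclicSections : Cmd :=
  seq (generate .stage isCommutator) <|
  seq (nil .cyclic) <|
  seq (push .cyclic .stage) <|
  forE .step (ite (mem .step .group) enlarge skip)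

variable {G : Type*} [Group G] {n : ℕ} {e : G ≃ Fin n} {K B : ℕ} {v : ElemReg → G} {a : Store G}
  {H N Q : Subgroup G} {g : G}

theorem adds_candidate (hH : a.set .group = H) (hQ : a.set .stage = Q) (hN : a.set .kernel = N)
    (hDN : ⁅H, H⁆ ≤ N) (hNQ : N ≤ Q) (hQH : Q ≤ H) :
    candidate.Adds e K B .nextCyclic {M | M = N ⊔ Subgroup.zpowers (v .generator) ∧
      v .generator ∈ Q ∧ CyclicIn M Q} v a := by
  refine .of_seq (wp_generate (insert (v .generator) (N : Set G)) (by decide) hH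
    fun g b hab => ?_) (by decide) fun b hab hb => ?_
  · simp [hab.set .kernel (by decide), hN, or_comm]
  have hbQ : b.set .stage = Q := (hab.set .stage (by decide)).trans hQ
  refine .of_seq (wp_generators (by decide) ((hab.set .group (by decide)).trans hH)) (by decide)
    fun c hbc hc => .pushNewIf (by decide) ?_ fun M => ?_ <;>
    rw [hbc.set .target (by decide), hb]
  · exact fun _ => ⟨_, rfl⟩
  · simp only [sat_and, sat_mem, sat_ex, Function.update_self, hbc.set .stage (by decide), hbQ, hc,
      hb, SetLike.mem_coe, SetLike.coe_set_eq, Set.mem_ofPred_eq]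
    by_cases hy : v .generator ∈ Q
    · have hle : N ⊔ Subgroup.zpowers (v .generator) ≤ Q := sup_le hNQ (by simpa using hy)
      rw [conjClosure_insert_eq_sup hDN (hNQ.trans hQH) (hQH hy),
        ← cyclicIn_iff_exists_conjClosure_eq (hDN.trans le_sup_left) hle hQH]
      aesop
    · simp [hy]

theorem adds_extend (hB : Nat.card G ≤ B) (hH : a.set .group = H)
    (hQ : a.set .stage = (Q ⊔ Subgroup.zpowers g : Subgroup G)) (hDQ : ⁅H, H⁆ ≤ Q) (hQH : Q ≤ H)
    (hg : g ∈ H) (hcyclic : Lists (cyclicFamily H Q) (a.list .cyclic)) :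
    extend.Adds e K B .nextCyclic (cyclicFamily H (Q ⊔ Subgroup.zpowers g)) v a := by
  have hfin : Finite G := .of_equiv _ e.symm
  rw [← iUnion_cyclicFamily_eq hDQ hQH hg]
  refine .forL _ hcyclic ((ncard_cyclicFamily_le H Q).trans hB) (by decide)
    fun N hN b hab hb => .forE _ fun y c hbc => ?_
  have hcH : c.set .group = H :=
    (hbc.set .group (by decide)).trans ((hab.set .group (by decide)).trans hH)
  have hcQ := (hbc.set .stage (by decide)).trans ((hab.set .stage (by decide)).trans hQ)
  have hcN : c.set .kernel = N := (hbc.set .kernel (by decide)).trans hb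
  simpa using adds_candidate (v := Function.update v .generator y) hcH hcQ hcN hN.1
    (hN.2.1.1.trans le_sup_left) (sup_le hQH (by simpa using hg))

theorem wp_enlarge (hB : Nat.card G ≤ B) (hH : a.set .group = H) (hQ : a.set .stage = Q)
    (hDQ : ⁅H, H⁆ ≤ Q) (hQH : Q ≤ H) (hv : v .step ∈ H)
    (hcyclic : Lists (cyclicFamily H Q) (a.list .cyclic)) :
    enlarge.wp e K B (fun b => b.set .stage = (Q ⊔ Subgroup.zpowers (v .step) : Subgroup G) ∧
      Lists (cyclicFamily H (Q ⊔ Subgroup.zpowers (v .step))) (b.list .cyclic)) v a := by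
  have hfin : Finite G := .of_equiv _ e.symm
  have hadd : (seq (add .step .stage) (close .stage)).wp e K B
      (fun b => b.set .stage = (Q ⊔ Subgroup.zpowers (v .step) : Subgroup G)) v a := by
    refine wp_mono (fun b hb => hb.trans ?_) (wp_close (a := a.setSet .stage _) (by decide) hH)
    simp [hQ, conjClosure_insert_eq_sup hDQ hQH hv]
  refine wp_seq hadd fun b hab hb => ?_
  refine wp_seq (C := nil .nextCyclic) (Ψ := fun c => c.list .nextCyclic = []) (by simp [wp])
    fun c hbc hc => ?_
  have hset : ∀ r, c.set r = b.set r := fun r => hbc.set r (by simp [sets])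
  have hcH : c.set .group = H := by rw [hset, hab.set .group (by decide), hH]
  have hlist : c.list .cyclic = a.list .cyclic :=
    (hbc.list _ (by decide)).trans (hab.list _ (by simp [lists, close, grow]))
  have hBP := (ncard_cyclicFamily_le H (Q ⊔ Subgroup.zpowers (v .step))).trans hB
  refine wp_seq (adds_extend hB hcH ((hset _).trans hb) hDQ hQH hv (hlist ▸ hcyclic) ∅
    (by rw [hc]; exact .nil) (by simpa using hBP)) fun d hcd hd => ?_
  refine wp_of_wp (wp_copy (by decide) (by simpa using hd) hBP) fun c' hdc' hc' => ⟨?_, hc'⟩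
  rw [hdc'.set .stage (by decide), hcd.set .stage (by decide), hset, hb]

theorem sat_isCommutator (h : a.set .group = H) :
    isCommutator.Sat v a.set ↔ ∃ x ∈ H, ∃ y ∈ H, x * y = v .x₁ * (y * x) := by
  simp [isCommutator, h, eq_comm (a := v .x₁ * _)]

theorem wp_forE_enlarge (hB : Nat.card G ≤ B) (hH : a.set .group = H)
    (hstage : a.set .stage = (⁅H, H⁆ : Subgroup G)) (hcyclic : a.list .cyclic = [⁅H, H⁆]) :
    (forE .step (ite (mem .step .group) enlarge skip)).wp e K B
      (fun b => Lists {N | CyclicIn N H} (b.list .cyclic)) v a := by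
  refine wp_mono (fun b hb => ?_) (wp_forE (fun V b => ∃ Q : Subgroup G, ⁅H, H⁆ ≤ Q ∧ Q ≤ H ∧
    V ∩ H ⊆ Q ∧ b.set .stage = Q ∧ Lists (cyclicFamily H Q) (b.list .cyclic)) ?_
    fun V g _ b hab ⟨Q, hDQ, hQH, hVQ, hbQ, hbc⟩ => ⟨fun hg => ?_, fun hg => ?_⟩)
  · obtain ⟨Q, -, hQH, hQ, -, hbQ⟩ := hb
    rw [Set.univ_inter] at hQ
    obtain rfl : Q = H := le_antisymm hQH hQ
    rwa [cyclicFamily_self] at hbQ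
  · refine ⟨_, le_rfl, H.commutator_le_self, by simp, hstage, ?_⟩
    rw [hcyclic, cyclicFamily_commutator]
    exact ⟨by simp, by simp⟩
  all_goals
    have hbH : b.set .group = H := (hab.set .group (by decide)).trans hH
    rw [sat_mem, Function.update_self, hbH, SetLike.mem_coe] at hg
  · refine wp_mono (fun c hc => ⟨_, hDQ.trans le_sup_left, sup_le hQH ?_, ?_, hc⟩)
      (wp_enlarge hB hbH hbQ hDQ hQH (by simpa using hg) hbc)
    · simpa using hg
    · rintro x ⟨rfl | hx, hxH⟩
      · simp [Subgroup.mem_sup_right]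
      · exact (le_sup_left : Q ≤ _) (hVQ ⟨hx, hxH⟩)
  · refine ⟨Q, hDQ, hQH, ?_, hbQ, hbc⟩
    rintro x ⟨rfl | hx, hxH⟩
    exacts [absurd hxH hg, hVQ ⟨hx, hxH⟩]

theorem wp_cyclicSections (hB : Nat.card G ≤ B) (hH : a.set .group = H) :
    cyclicSections.wp e K B (fun b => Lists {N | CyclicIn N H} (b.list .cyclic)) v a := by
  refine wp_seq (wp_generate {g | ∃ x ∈ H, ∃ y ∈ H, x * y = g * (y * x)} (by decide) hH
    fun g b hab => ?_) fun b hab hb => ?_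
  · rw [sat_isCommutator ((hab.set .group (by decide)).trans hH), Function.update_self]
    rfl
  · rw [conjClosure_commutators] at hb
    refine ⟨⁅H, H⁆, hb.symm, wp_forE_enlarge hB ?_ hb (by simp)⟩
    exact (hab.set .group (by decide)).trans hH

end Cmd

/-! ## Programs for simple sections and series -/

namespace OutputsSubgroups

variable {G : Type*} [Group G] {n : ℕ} {e : G ≃ Fin n} {S S' : Subgroup G → Prop} {N : Subgroup G}
  {out o : List ℕ}

theorem nil (hS : ∀ A, ¬ S A) : OutputsSubgroups e S [] :=
  ⟨[], [], List.nodup_nil, by simp [hS], .nil, rfl⟩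

theorem concat (h : OutputsSubgroups e S out) (ho : ListsElements e N o) (hN : ¬ S N)
    (hS' : ∀ A, S' A ↔ S A ∨ A = N) : OutputsSubgroups e S' (out ++ o.length :: o) := by
  obtain ⟨As, L, hnodup, hAs, hL, rfl⟩ := h
  refine ⟨As ++ [N], L ++ [o], List.nodup_append.2 ⟨hnodup, List.nodup_singleton N, ?_⟩,
    fun A => by simp [hAs, hS'], List.rel_append hL (.cons ho .nil), by simp⟩
  rintro A hA _ hA' rfl
  exact hN (List.mem_singleton.1 hA' ▸ (hAs A).1 hA)

end OutputsSubgroups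

namespace Cmd

open Fml

/-- Compute in `target` the set `avoiding H x` for the subgroup `H` in `group` and the value `x` of
`avoided`. -/
def avoid : Cmd :=
  collect .member .target (generate .closure (eq .x₁ .member))
    (and (mem .member .group) (neg (mem .avoided .closure)))

/-- If the set computed by `avoid` is a normal subgroup of `group` with simple quotient, then add it
to the list `nextLevel`. -/
def simpleCandidate : Cmd :=
  seq avoid <|
  seq (generate .kernel (mem .x₁ .target)) <|
  seq (generators .group) <|
  pushNewIf (and (mem .avoided .group) (and (eqSet .kernel .target) (all .x₁
    (imp (mem .x₁ .group) (or (mem .x₁ .target) (mem .x₁ .generators)))))) .nextLevel .target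

/-- Add the normal subgroups of `group` with cyclic or simple quotient to the list `nextLevel`. -/
def sections : Cmd :=
  seq cyclicSections <|
  seq (forL .cyclic .kernel (pushNew .nextLevel .kernel)) <|
  forE .avoided simpleCandidate

/-- Replace the list `level` of subgroups by the list of their normal subgroups with cyclic or
simple quotient. -/
def descend : Cmd :=
  seq (nil .nextLevel) (seq (forL .level .group sections) (copy .nextLevel .level))

/-- The subgroup `group` is normal in the whole group. -/
def isInvariant : Fml :=
  all .x₁ <| all .x₂ <| all .x₃ <| all .x₄ <|
    imp (and (mem .x₂ .group) (and (mul .x₁ .x₂ .x₃) (mul .x₄ .x₁ .x₃))) (mem .x₄ .group)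

/-- Output the normal subgroups that are reached from the whole group by descending series with
cyclic or simple factors, of a length that is the number of repetitions of `descend`. -/
def enumerate : Cmd :=
  seq (define .group (eq .x₁ .x₁)) <|
  seq (push .level .group) <|
  seq (rep descend) <|
  forL .level .group (ite isInvariant (emit .group) skip)

variable {G : Type*} [Group G] {n : ℕ} {e : G ≃ Fin n} {K B : ℕ} {v : ElemReg → G} {a : Store G}
  {H N : Subgroup G}

theorem wp_avoid (hH : a.set .group = H) :
    avoid.wp e K B (fun b => b.set .target = avoiding H (v .avoided)) v a := by
  refine wp_collect _ (by decide) fun g b hab => ?_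
  refine wp_of_wp (wp_generate {g} (by decide) ((hab.set .group (by decide)).trans hH)
    fun _ _ _ => ?_) fun c hbc hc => ?_
  · simp
  · simp [hbc.set .group (by decide), hab.set .group (by decide), hH, hc, avoiding]

theorem adds_simpleCandidate (hH : a.set .group = H) :
    simpleCandidate.Adds e K B .nextLevel {N | v .avoided ∈ H ∧ SimpleIn N H ∧
      (N : Set G) = avoiding H (v .avoided)} v a := by
  refine .of_seq (wp_avoid hH) (by decide) fun b hab hb => ?_
  have hbH : b.set .group = H := (hab.set .group (by decide)).trans hH
  refine .of_seq (wp_generate (avoiding H (v .avoided)) (by decide) hbH fun g c hbc => ?_)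
    (by decide) fun c hbc hc => ?_
  · simp [hbc.set .target (by decide), hb]
  have hcH : c.set .group = H := (hbc.set .group (by decide)).trans hbH
  have hcT : c.set .target = avoiding H (v .avoided) := (hbc.set .target (by decide)).trans hb
  refine .of_seq (wp_generators (by decide) hcH) (by decide)
    fun d hcd hd => .pushNewIf (by decide) ?_ fun N => ?_
  all_goals
    simp only [sat_and, sat_mem, sat_eqSet, sat_all, sat_imp, sat_or, Function.update_self, hd, hcH,
      hcd.set .group (by decide), hcd.set .target (by decide), hcd.set .kernel (by decide), hcT, hc]
  · exact fun h => ⟨_, h.2.1.symm⟩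
  · rw [Set.mem_ofPred_eq, ← and_assoc (b := SimpleIn N H), eq_comm (b := (N : Set G))]
    refine and_congr_left fun hN => and_congr_right fun hx => ?_
    have hNH : N ≤ H := fun y hy => (hN.subset hy).1
    have hnormal : conjClosure H (N : Set G) = N ↔ NormalIn N H :=
      ⟨fun h => h ▸ normalIn_conjClosure hNH, conjClosure_eq_self⟩
    rw [simpleIn_iff_of_eq_avoiding hx hN, ← hN, SetLike.coe_set_eq, hnormal]
    refine and_congr_right fun _ => forall₂_congr fun y hy => or_congr_right ?_
    simpa [SetLike.coe_set_eq] using fun _ => hy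

theorem adds_sections (hB : Nat.card G ≤ B) (hH : a.set .group = H) :
    sections.Adds e K B .nextLevel {N | SectionStep H N} v a := by
  have hfin : Finite G := .of_equiv _ e.symm
  rw [setOf_sectionStep_eq]
  refine .of_seq (wp_cyclicSections hB hH) (by decide) fun b hab hb => .seq
    (.forL_pushNew (by decide) (by decide) hb ?_) fun c hbc => .forE _ fun x d hcd => ?_
  · exact ((ncard_cyclicIn_le H).trans (Subgroup.card_le_card_group H)).trans hB
  · have hdH : d.set .group = H := by
      rw [hcd.set .group (by decide), hbc.set .group (by decide), hab.set .group (by decide), hH]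
    simpa using adds_simpleCandidate (v := Function.update v .avoided x) hdH

theorem wp_descend {i : ℕ} (hB : Nat.card G ≤ B) (hi : (seriesLevel G i).ncard ≤ B)
    (hi' : (seriesLevel G (i + 1)).ncard ≤ B) (hlevel : Lists (seriesLevel G i) (a.list .level)) :
    descend.wp e K B (fun b => Lists (seriesLevel G (i + 1)) (b.list .level)) v a := by
  refine wp_seq (C := nil .nextLevel) (Ψ := fun b => b.list .nextLevel = []) (by simp [wp])
    fun b hab hb => ?_
  have hsections : (forL .level .group sections).Adds e K B .nextLevel
      (seriesLevel G (i + 1)) v b := by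
    rw [show seriesLevel G (i + 1) = ⋃ H ∈ seriesLevel G i, {N | SectionStep H N} by
      ext; simp [seriesLevel]]
    exact .forL _ (by rwa [hab.list .level (by decide)]) hi (by decide)
      fun H _ c _ hc => adds_sections hB hc
  refine wp_seq (hsections ∅ (by rw [hb]; exact .nil) (by simpa using hi')) fun c _ hc => ?_
  exact wp_copy (by decide) (by simpa using hc) hi'

theorem sat_isInvariant (h : a.set .group = H) : isInvariant.Sat v a.set ↔ H.Normal := by
  simp only [isInvariant, sat_all, sat_imp, sat_and, sat_mem, sat_mul, h]
  simp only [Function.update_self, ne_eq, reduceCtorEq, not_false_eq_true, Function.update_of_ne]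
  refine ⟨fun hinv => ⟨fun x hx g => hinv g x (g * x) (g * x * g⁻¹) (by simpa using hx)⟩, ?_⟩
  rintro hnormal g x y z ⟨hx, rfl, hz⟩
  rw [eq_mul_inv_of_mul_eq hz]
  exact hnormal.conj_mem x hx g

theorem wp_forL_emit {𝒱 : Set (Subgroup G)} (h𝒱 : Lists 𝒱 (a.list .level)) (hB : 𝒱.ncard ≤ B)
    (ho : a.out = []) :
    (forL .level .group (ite isInvariant (emit .group) skip)).wp e K B
      (fun c => OutputsSubgroups e (fun A => A ∈ 𝒱 ∧ A.Normal) c.out) v a := by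
  refine wp_forL h𝒱 hB (by decide)
    (fun V c => OutputsSubgroups e (fun A => A ∈ V ∧ A.Normal) c.out)
    (by simpa [ho] using .nil (by simp)) fun V _ N _ hNV b _ hb => ⟨fun h => ?_, fun h => ?_⟩ <;>
    rw [sat_isInvariant (H := N) (by simp)] at h
  · refine ⟨N, by simp, fun o ho => hb.concat ho (by simp [hNV]) fun A => ?_⟩
    rw [Set.mem_insert_iff]
    exact ⟨fun hA => hA.1.symm.imp_left (⟨·, hA.2⟩), by rintro (hA | rfl) <;> simp [*]⟩
  · suffices ∀ A : Subgroup G, A ∈ insert N V ∧ A.Normal ↔ A ∈ V ∧ A.Normal by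
      simpa only [wp, this, Store.out_setSet] using hb
    exact fun A => and_congr_left fun hA => or_iff_right (by rintro rfl; exact h hA)

theorem wp_enumerate (hB : Nat.card G ≤ B) (hlev : ∀ i ≤ K, (seriesLevel G i).ncard ≤ B)
    (hl : a.list .level = []) (ho : a.out = []) :
    enumerate.wp e K B
      (fun c => OutputsSubgroups e (fun A => A ∈ seriesLevel G K ∧ A.Normal) c.out) v a := by
  refine wp_seq (wp_define Set.univ fun g b _ => by simp) fun b hab hb => ?_
  refine wp_seq (C := push .level .group) (Ψ := fun c => Lists (seriesLevel G 0) (c.list .level))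
    ⟨⊤, by simp [hb], ?_⟩ fun c hbc hc => ?_
  · simp [hab.list .level (by decide), hl, Lists, seriesLevel]
  refine wp_seq (wp_rep (fun i d => Lists (seriesLevel G i) (d.list .level)) hc fun i hi d _ hd =>
    wp_descend hB (hlev i hi.le) (hlev (i + 1) hi) hd) fun d hcd hd => ?_
  refine wp_forL_emit hd (hlev K le_rfl) ?_
  rw [hcd.out rfl, hbc.out rfl, hab.out rfl, ho]

end Cmd

/-! ## The enumeration algorithm -/

/-- Replace the prescribed length of the series by `0` for the trivial group, whose subgroup occurs
at every level of the descending series although no power of its order bounds the length. -/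
def truncateProg : Prog :=
  .cond (.sub (.var VarSlot.size) (.const 1)) .skip (.assign VarSlot.iter (.const 0))

/-- Store the multiples of the order of the group in the array `offset`. -/
def offsetProg : Prog :=
  .countTo VarSlot.size (VarSlot.scratch 0) <|
    .seq (.store ArrSlot.offset (.var (VarSlot.scratch 0)) (.var (VarSlot.scratch 1))) <|
    .assign (VarSlot.scratch 1) (.add (.var (VarSlot.scratch 1)) (.var VarSlot.size))

/-- Output the normal subgroups whose quotients have a series of given length with cyclic or simple
factors. -/
def enumerationProg : Prog :=
  .seq truncateProg <| .seq offsetProg <| Cmd.enumerate.prog 0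

section

variable {G : Type*} [Group G] {n : ℕ} (e : G ≃ Fin n) {B : ℕ} (k : ℕ)

theorem cayleyInputWith_table (g h : G) :
    (cayleyInputWith e k).arr ArrSlot.table ((e g : ℕ) * n + e h) = e (g * h) := by
  have hlt : (e g : ℕ) * n + e h < n * n := by nlinarith [(e g).2, (e h).2]
  have hdiv : Fin.divNat ⟨(e g : ℕ) * n + e h, hlt⟩ = e g := by
    ext
    simp [mul_comm _ n, Nat.mul_add_div (Fin.pos (e h)), Nat.div_eq_of_lt (e h).2]
  have hmod : Fin.modNat ⟨(e g : ℕ) * n + e h, hlt⟩ = e h := by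
    ext
    simp [Nat.mod_eq_of_lt (e h).2]
  simp [cayleyInputWith, cayleyInput, ArrSlot.code, hlt, hdiv, hmod]

theorem runs_truncateProg : Runs B truncateProg (cayleyInputWith e k) fun s =>
    s = cayleyInputWith e (if n = 1 then 0 else k) := by
  have hn : 0 < n := Fin.pos (e 1)
  refine .cond (fun h => .skip ?_) fun h => .assign ?_ <;>
    simp only [Expr.eval, VarSlot.code, cayleyInputWith, cayleyInput, Function.update_of_ne,
      if_true, ne_eq, zero_ne_one, not_false_eq_true] at h
  · rw [if_neg (by omega)]
  · rw [if_pos (by omega)]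
    simp [State.setVar, cayleyInputWith, VarSlot.code, Expr.eval]

theorem represents_of_eq_cayleyInputWith {s : State}
    (hvar : ∀ i : VarSlot, (∀ d, i ≠ .scratch d) → s.var i = (cayleyInputWith e k).var i)
    (harr : ∀ j : ArrSlot, j ≠ .offset → s.arr j = (cayleyInputWith e k).arr j)
    (hoffset : ∀ i < n, s.arr ArrSlot.offset i = i * n) (hout : s.out = []) :
    Represents e k s (fun _ => e.symm ⟨0, Fin.pos (e 1)⟩) []
      ⟨fun _ => ∅, fun _ => [], []⟩ where
  size := by rw [hvar _ (by simp)]; simp [cayleyInputWith, cayleyInput, VarSlot.code]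
  iter := by rw [hvar _ (by simp)]; simp [cayleyInputWith, VarSlot.code]
  table g h := by rw [harr _ (by simp), cayleyInputWith_table]
  offset g := hoffset _ (e g).2
  elem x := by rw [hvar _ (by simp)]; simp [cayleyInputWith, cayleyInput, VarSlot.code]
  set r g := by rw [harr _ (by simp)]; simp [cayleyInputWith, cayleyInput, ArrSlot.code]
  len l := by rw [hvar _ (by simp)]; simp [cayleyInputWith, cayleyInput, VarSlot.code]
  row l i hi := by simp at hi
  scratch j r hr := by simp at hr
  out := hout

theorem runs_offsetProg (hB : n ≤ B) : Runs B offsetProg (cayleyInputWith e k) fun s =>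
    Represents e k s (fun _ => e.symm ⟨0, Fin.pos (e 1)⟩) [] ⟨fun _ => ∅, fun _ => [], []⟩ := by
  refine .countTo n hB (by simp [cayleyInputWith, cayleyInput, VarSlot.code]) (by simp)
    (fun i s => (∀ j : VarSlot, (∀ d, j ≠ .scratch d) → s.var j = (cayleyInputWith e k).var j) ∧
      s.var (VarSlot.scratch 1) = i * n ∧
      (∀ j : ArrSlot, j ≠ .offset → s.arr j = (cayleyInputWith e k).arr j) ∧
      (∀ j < i, s.arr ArrSlot.offset j = j * n) ∧ s.out = []) ?_ ?_ ?_
  · refine ⟨fun j hj => by simp [hj], ?_, fun _ _ => rfl, by simp, rfl⟩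
    simp [cayleyInputWith, cayleyInput, VarSlot.code]
  · rintro i - s hi hn ⟨hvar, hlast, harr, hoffset, hout⟩
    refine .seq (.store (.assign ⟨by simpa using hi, by simpa using hn, fun j hj => ?_, ?_,
      fun j hj => ?_, fun j hj => ?_, hout⟩))
    · simp [hj, hvar j hj]
    · simp [Expr.eval, hlast, hn, add_mul]
    · ext; simp [hj, harr j hj]
    · rcases Nat.lt_succ_iff_lt_or_eq.1 hj with hj | rfl
      · simp [Expr.eval, hi, hj.ne, hoffset j hj]
      · simp [Expr.eval, hi, hlast]
  · rintro s ⟨hvar, -, harr, hoffset, hout⟩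
    exact represents_of_eq_cayleyInputWith e k hvar harr hoffset hout

end

theorem seriesLevel_eq_of_subsingleton {G : Type*} [Group G] [Subsingleton G] (i j : ℕ) :
    seriesLevel G i = seriesLevel G j := by
  have top_mem : ∀ i, (⊤ : Subgroup G) ∈ seriesLevel G i := fun i => by
    induction i with
    | zero => rfl
    | succ i ih => exact ⟨⊤, ih, .inl ⟨normalIn_self _, 1, trivial, le_sup_left⟩⟩
  ext A
  simp [Subsingleton.elim A ⊤, top_mem]

theorem two_mul_pow_le_sq {n i k : ℕ} (hn : n ≠ 0) (hi : i ≤ if n = 1 then 0 else k) :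
    (2 * n) ^ i ≤ (n ^ k) ^ 2 := by
  split_ifs at hi with h
  · simp [h, Nat.le_zero.1 hi]
  · calc (2 * n) ^ i ≤ (n * n) ^ i := by gcongr; omega
      _ ≤ (n * n) ^ k := Nat.pow_le_pow_right (by positivity) hi
      _ = (n ^ k) ^ 2 := by rw [mul_pow, sq]

theorem runs_enumerationProg {G : Type*} [Group G] {n k : ℕ} (e : G ≃ Fin n) (hk : 1 ≤ k) :
    Runs ((n ^ k) ^ 2) enumerationProg (cayleyInputWith e k) fun s =>
      OutputsSubgroups e (fun A => ∃ _ : A.Normal, HasCyclicOrSimpleSeries (G ⧸ A) k) s.out := by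
  have hfin : Finite G := .of_equiv _ e.symm
  have hcard : Nat.card G = n := by simpa using Nat.card_congr e
  have hn : 0 < n := Fin.pos (e 1)
  have hB : n ^ k ≤ (n ^ k) ^ 2 := Nat.le_self_pow two_ne_zero _
  have hnB : n ≤ (n ^ k) ^ 2 := (Nat.le_self_pow (by omega) n).trans hB
  set K := if n = 1 then 0 else k with hK
  have hKB : K ≤ (n ^ k) ^ 2 := by
    rw [hK]
    split_ifs with h
    · exact Nat.zero_le _
    · exact (Nat.lt_pow_self (by omega)).le.trans hB
  have hlevel : seriesLevel G K = seriesLevel G k := by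
    rw [hK]
    split_ifs with h
    · have : Subsingleton G := (Nat.card_eq_one_iff_unique.1 (hcard.trans h)).1
      exact seriesLevel_eq_of_subsingleton 0 k
    · rfl
  refine .seq ((runs_truncateProg e k).mono fun s hs => .seq ?_)
  refine (hs ▸ runs_offsetProg e K hnB).mono fun s hs => ?_
  refine (Cmd.enumerate.runs hnB hn hKB hs (Cmd.wp_enumerate (hcard.trans_le hnB) (fun i hi => ?_)
    rfl rfl)).mono fun s ⟨b, hb, hout⟩ => ?_
  · exact (ncard_seriesLevel_le i).trans (by rw [hcard]; exact two_mul_pow_le_sq hn.ne' hi)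
  · simpa only [hb.out, hlevel, exists_prop, and_comm, hasCyclicOrSimpleSeries_quotient_iff]
      using hout

theorem mainTheorem10 :
    (∃ (P : RAM.Prog) (p : Polynomial ℕ), ∀ (G : Type*) [Group G] (n : ℕ) (e : G ≃ Fin n)
      (k : ℕ), 1 ≤ k →
        FindsSubgroupsInTime e P (cayleyInputWith e k) (p.eval (n ^ k))
          (fun A => ∃ _ : A.Normal, HasCyclicOrSimpleSeries (G ⧸ A) k)) ∧
    (∃ (P : RAM.Prog) (p : Polynomial ℕ), ∀ (G : Type*) [Group G] (n : ℕ) (e : G ≃ Fin n),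
        FindsSubgroupsInTime e P (cayleyInput e) (p.eval n)
          (fun A => ∃ _ : A.Normal, IsCyclicOrSimple (G ⧸ A))) := by
  refine ⟨⟨enumerationProg, enumerationProg.time.comp (Polynomial.X ^ 2), ?_⟩,
    ⟨.seq (.assign 1 (.const 1)) enumerationProg,
      (Prog.seq (.assign 1 (.const 1)) enumerationProg).time.comp (Polynomial.X ^ 2), ?_⟩⟩
  · intro G _ n e k hk
    obtain ⟨t, s, h1, h2, h3⟩ := runs_enumerationProg e hk
    exact ⟨t, s, h1, by simpa [Polynomial.eval_comp] using h2, h3⟩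
  · intro G _ n e
    obtain ⟨t, s, h1, h2, h3⟩ : Runs ((n ^ 1) ^ 2) (.seq (.assign 1 (.const 1)) enumerationProg)
        (cayleyInput e) _ := .seq (.assign (runs_enumerationProg e le_rfl))
    refine ⟨t, s, h1, by simpa [Polynomial.eval_comp] using h2, ?_⟩
    convert h3 using 2 with A
    exact exists_congr fun _ => (hasCyclicOrSimpleSeries_one_iff A).symm
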